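/- Let $\mathcal G=\{G^{(t)}\}_{t=0}^\infty$ be an $n$-node dynamic network, i.e. a sequence of simple graphs on a common set $V$ of $n\ge 1$ nodes; the graph $G^{(t)}$ is exposed at time $t$ and is in force during $[t,t+1)$. The sequence may be fixed in advance, or $G^{(t)}$ may depend (measurably) on what has happened up to time $t$, but not on the future. Asynchronous algorithm: at time $0$ exactly one node $v_0$ knows a rumor. Every node has an independent Poisson clock of rate $1$; whenever the clock of a node ticks, the node contacts a uniformly random neighbour in the graph currently in force (nobody, if it has no neighbour), all choices being independent, and if one of the two nodes knows the rumor then both know it afterwards. Let $\tau_{\mathrm{all}}(\mathcal G,v_0)\in[0,\infty]$ be the first time at which all nodes know the rumor. For a graph $G$ on $V$ let $d_u$ be the degree of $u$, $\mathrm{vol}(S)=\sum_{u\in S}d_u$, $\mathrm{vol}(G)=\mathrm{vol}(V)$, $\bar d(S)=\mathrm{vol}(S)/|S|$, and let $E(S,\overline S)$ be the set of edges between $S$ and $\overline S=V\setminus S$. Define $$\Phi(G)=\min_{\emptyset\ne S\subsetneq V}\frac{|E(S,\overline S)|}{\min\{\mathrm{vol}(S),\mathrm{vol}(\overline S)\}},\qquad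 \rho(G)=\min_{0<\mathrm{vol}(S)\le \mathrm{vol}(G)/2}\ \min_{\{u,w\}\in E(S,\overline S)}\max\Big\{\frac{\bar d(S)}{d_u},\frac{\bar d(S)}{d_w}\Big\}$$ if $G$ is connected, with $\Phi(G)=\rho(G)=0$ if $G$ is not connected or $n=1$; further $\lceil\Phi(G)\rceil=1$ if $G$ is connected and $0$ otherwise, and $$\overline\rho(G)=\min_{\{u,w\}\in E(G)}\max\{1/d_u,1/d_w\},$$ with $\overline\rho(G)=0$ if $G$ has no edge. For $c>1$ put $c_0=\tfrac12-\tfrac1{\mathrm e}$, $C=(10c+20)/c_0$, $$T(\mathcal G,c)=\min\Big\{t\in\mathbb N:\sum_{p=0}^t\Phi(G^{(p)})\,\rho(G^{(p)})\ge C\log n\Big\},\qquad T_{abs}(\mathcal G)=\min\Big\{t\in\mathbb N:\sum_{p=0}^t\lceil\Phi(G^{(p)})\rceil\,\overline\rho(G^{(p)})\ge 2n\Big\},$$ where $\mathbb N=\{0,1,2,\dots\}$, $\log$ is the natural logarithm and $\min\emptyset=\infty$. Statement. Let $c>1$. There is $n_0=n_0(c)$ such that for every $n\ge n_0$, every $n$-node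 dynamic network $\mathcal G$ and every starting node $v_0$, with probability at least $1-n^{-c}$, $$\tau_{\mathrm{all}}(\mathcal G,v_0)\le\min\{T(\mathcal G,c),\,T_{abs}(\mathcal G)\}.$$ Moreover the bound $\tau_{\mathrm{all}}(\mathcal G,v_0)\le T(\mathcal G,c)$ holds with probability at least $1-n^{-c}$ for every $n\ge1$, every $n$-node dynamic network and every $v_0$. -/

import Mathlib

open MeasureTheory ProbabilityTheory
open scoped ENNReal NNReal

noncomputable section

namespace RumorSpreading

/-! ### Graph parameters -/

section GraphParameters

open Classical in
/-- The volume `vol(S) = ∑_{u ∈ S} d_u`. -/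
def vol {n : ℕ} (G : SimpleGraph (Fin n)) (S : Finset (Fin n)) : ℝ :=
  ∑ u ∈ S, (G.degree u : ℝ)

open Classical in
/-- The number `|E(S, Sᶜ)|` of edges crossing the cut. An ordered pair in `interedges S Sᶜ` has its
first entry in `S` and its second entry in `Sᶜ`, so every crossing edge is counted once. -/
def cutSize {n : ℕ} (G : SimpleGraph (Fin n)) (S : Finset (Fin n)) : ℝ :=
  ((G.interedges S Sᶜ).card : ℝ)

/-- The conductance `Φ(G)`: the minimum of `|E(S, Sᶜ)| / min (vol S) (vol Sᶜ)` over the nonempty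
proper subsets `S` of the vertex set (a minimum over a finite family of nonnegative numbers).
A quotient `0 / 0` occurs only if the graph has isolated vertices and `n ≥ 2`, hence is disconnected;
it is read as `0`, so that `Φ = 0` for every disconnected graph. -/
def conductance {n : ℕ} (G : SimpleGraph (Fin n)) : ℝ :=
  sInf {x : ℝ | ∃ S : Finset (Fin n), S.Nonempty ∧ S ≠ Finset.univ ∧
    x = cutSize G S / min (vol G S) (vol G Sᶜ)}

open Classical in
/-- The diligence `ρ(S)` of a cut: the minimum over crossing edges `{u, w}` of
`max (d̄(S) / d_u) (d̄(S) / d_w)`, where `d̄(S) = vol S / |S|`. -/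
def cutDiligence {n : ℕ} (G : SimpleGraph (Fin n)) (S : Finset (Fin n)) : ℝ :=
  sInf {x : ℝ | ∃ u ∈ S, ∃ w ∉ S, G.Adj u w ∧
    x = max (vol G S / (S.card : ℝ) / (G.degree u : ℝ)) (vol G S / (S.card : ℝ) / (G.degree w : ℝ))}

open Classical in
/-- The diligence `ρ(G)`: the minimum of `ρ(S)` over `S` with `0 < vol S ≤ vol G / 2` if `G` is
connected, and `0` otherwise. -/
def diligence {n : ℕ} (G : SimpleGraph (Fin n)) : ℝ :=
  if G.Connected then
    sInf {x : ℝ | ∃ S : Finset (Fin n), 0 < vol G S ∧ vol G S ≤ vol G Finset.univ / 2 ∧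
      x = cutDiligence G S}
  else 0

open Classical in
/-- The absolute diligence: the minimum over edges `{u, w}` of `max (1 / d_u) (1 / d_w)`; it is `0`
for a graph without edges (`sInf ∅ = 0`). -/
def absDiligence {n : ℕ} (G : SimpleGraph (Fin n)) : ℝ :=
  sInf {x : ℝ | ∃ u w : Fin n, G.Adj u w ∧
    x = max (1 / (G.degree u : ℝ)) (1 / (G.degree w : ℝ))}

open Classical in
/-- `⌈Φ(G)⌉`, which is `1` if `G` is connected and `0` otherwise. -/
def ceilConductance {n : ℕ} (G : SimpleGraph (Fin n)) : ℝ :=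
  if G.Connected then 1 else 0

end GraphParameters

/-! ### The clocks and the random choices -/

/-- An outcome: for every node `v` and every `k`, the waiting time `(ω (v, k)).1` between the ticks
number `k - 1` and `k` of the clock of `v` (from time `0` if `k = 0`), and the node
`(ω (v, k)).2 H` that `v` contacts at tick number `k` if the graph in force at that moment is `H`. -/
abbrev Outcome (n : ℕ) : Type := Fin n × ℕ → ℝ × (SimpleGraph (Fin n) → Fin n)

open Classical in
/-- The uniform distribution on the neighbours of `v` in `H`. An isolated node has nobody to contact;
the law is then the point mass at `v` itself, which has no effect on the process. -/
def neighborLaw {n : ℕ} (v : Fin n) (H : SimpleGraph (Fin n)) : Measure (Fin n) :=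
  if (H.neighborSet v).Nonempty then uniformOn (H.neighborSet v) else Measure.dirac v

instance {n : ℕ} (v : Fin n) (H : SimpleGraph (Fin n)) :
    IsProbabilityMeasure (neighborLaw v H) := by
  unfold neighborLaw
  split_ifs with h
  · exact isProbabilityMeasure_uniformOn (Set.toFinite _) h
  · infer_instance

instance : IsProbabilityMeasure (expMeasure 1) := isProbabilityMeasure_expMeasure one_pos

open Classical in
/-- The law of the clocks and choices: all waiting times and all choices are independent, the waiting
times are exponential with rate `1` (so that every node has a Poisson clock of rate `1`), and the
choices are uniform among the neighbours. -/
def law (n : ℕ) : Measure (Outcome n) :=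
  Measure.infinitePi fun i : Fin n × ℕ =>
    (expMeasure 1).prod (Measure.pi fun H : SimpleGraph (Fin n) => neighborLaw i.1 H)

/-- The time of tick number `k` of the clock of node `v`. -/
def tickTime {n : ℕ} (ω : Outcome n) (v : Fin n) (k : ℕ) : ℝ :=
  ∑ i ∈ Finset.range (k + 1), (ω (v, i)).1

/-! ### Dynamic networks -/

/-- Two outcomes agree up to time `t` if they have the same ticks, with the same choices, in
`[0, t]`. -/
def AgreeUpTo {n : ℕ} (t : ℝ) (ω ω' : Outcome n) : Prop :=
  ∀ v k, (tickTime ω v k ≤ t ∨ tickTime ω' v k ≤ t) → ω (v, k) = ω' (v, k)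

/-- A dynamic network on `n` nodes: a sequence of simple graphs `G⁽⁰⁾, G⁽¹⁾, …` on the same `n` nodes,
`G⁽ᵗ⁾` being exposed at time `t`. The graph exposed at time `t` may depend on what has happened up to
time `t` (for instance on the set of informed nodes), but not on the future. -/
structure DynamicNetwork (n : ℕ) where
  graph : ℕ → Outcome n → SimpleGraph (Fin n)
  measurableSet_graph : ∀ t H, MeasurableSet {ω | graph t ω = H}
  nonanticipating : ∀ (t : ℕ) (ω ω' : Outcome n), AgreeUpTo (t : ℝ) ω ω' → graph t ω = graph t ω'

/-- Every fixed sequence of graphs is a dynamic network. -/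
def DynamicNetwork.ofSequence {n : ℕ} (G : ℕ → SimpleGraph (Fin n)) : DynamicNetwork n where
  graph t _ := G t
  measurableSet_graph _ _ := MeasurableSet.const _
  nonanticipating _ _ _ _ := rfl

/-! ### The asynchronous algorithm -/

/-- `u` calls `w` at time `t`: the clock of `u` ticks at time `t`, and `u` chooses its neighbour `w`
in the graph `G ⌊t⌋` in force at that time. -/
def Calls {n : ℕ} (G : ℕ → SimpleGraph (Fin n)) (ω : Outcome n) (t : ℝ) (u w : Fin n) : Prop :=
  (G ⌊t⌋₊).Adj u w ∧ ∃ k, tickTime ω u k = t ∧ (ω (u, k)).2 (G ⌊t⌋₊) = w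

/-- `Informed G ω v₀ t u`: at time `t` node `u` knows the rumor, which `v₀` knows at time `0`.
Whenever one of two nodes calls the other and one of them knows the rumor, the other one learns it
(push or pull). -/
inductive Informed {n : ℕ} (G : ℕ → SimpleGraph (Fin n)) (ω : Outcome n) (v₀ : Fin n) :
    ℝ → Fin n → Prop
  | source : Informed G ω v₀ 0 v₀
  | keep {s t : ℝ} {u : Fin n} : Informed G ω v₀ s u → s ≤ t → Informed G ω v₀ t u
  | push {s t : ℝ} {u w : Fin n} :
      Informed G ω v₀ s u → s < t → Calls G ω t u w → Informed G ω v₀ t w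
  | pull {s t : ℝ} {u w : Fin n} :
      Informed G ω v₀ s u → s < t → Calls G ω t w u → Informed G ω v₀ t w

/-- The first time at which all nodes are informed (`∞` if there is none). -/
def spreadTime {n : ℕ} (𝒢 : DynamicNetwork n) (v₀ : Fin n) (ω : Outcome n) : ℝ≥0∞ :=
  ⨅ (τ : ℝ≥0) (_ : ∀ u, Informed (fun t => 𝒢.graph t ω) ω v₀ (τ : ℝ) u), (τ : ℝ≥0∞)

/-! ### The two bounds -/

/-- The constant `C = (10 c + 20) / c₀` with `c₀ = 1/2 - 1/e`. -/
def boundConst (c : ℝ) : ℝ := (10 * c + 20) / (1 / 2 - 1 / Real.exp 1)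

/-- `T(𝒢, c) = min {t : ∑_{p=0}^t Φ(G⁽ᵖ⁾) ρ(G⁽ᵖ⁾) ≥ C log n}` (`∞` if there is no such `t`). -/
def diligenceBound {n : ℕ} (𝒢 : DynamicNetwork n) (c : ℝ) (ω : Outcome n) : ℝ≥0∞ :=
  ⨅ (t : ℕ) (_ : boundConst c * Real.log n ≤
    ∑ p ∈ Finset.range (t + 1), conductance (𝒢.graph p ω) * diligence (𝒢.graph p ω)), (t : ℝ≥0∞)

/-- `T_abs(𝒢) = min {t : ∑_{p=0}^t ⌈Φ(G⁽ᵖ⁾)⌉ ρ̄(G⁽ᵖ⁾) ≥ 2 n}` (`∞` if there is no such `t`). -/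
def absDiligenceBound {n : ℕ} (𝒢 : DynamicNetwork n) (ω : Outcome n) : ℝ≥0∞ :=
  ⨅ (t : ℕ) (_ : 2 * (n : ℝ) ≤
    ∑ p ∈ Finset.range (t + 1), ceilConductance (𝒢.graph p ω) * absDiligence (𝒢.graph p ω)),
    (t : ℝ≥0∞)

end RumorSpreading

end

noncomputable section

namespace RumorSpreading

/-! ### The rate of crossing calls -/

/-! Let `I` be the informed set and `H` the graph in force. Calls across the cut `(I, Iᶜ)` occur at
rate `λ`, the sum of `1/d_u + 1/d_w` over crossing edges (`crossRate_eq`). Conductance counts the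
crossing edges and diligence bounds the contribution of each, so `λ ≥ Φ ρ min(|I|, n - |I|)`
(`conductance_mul_diligence_mul_min_le`). In a connected graph a single crossing edge already gives
`λ ≥ ρ̄` (`ceilConductance_mul_absDiligence_le`).

Time is cut into cells of length `1/n`. At most one generation of calls per cell is kept, which
yields a subset `gridInformed` of the informed nodes and can only delay the spreading. By
memorylessness of the clocks, given the past at the start of a cell, no call crosses the cut during
the cell with probability at most `exp(-(1 - exp(-1/n)) λ)` (`setLIntegral_noCross_le`). This holds
for adaptive networks, because the graph in force and the informed set are both determined by that
past.

Let `r` be the weight of a graph (`Φ ρ` or `⌈Φ⌉ ρ̄`). If `F` is decreasing with `F n = 0`, and a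
cell shrinks `F |I|` on average by a factor `1 - θ r / n`, then `exp(θ ∑ r) F |I|`, with the sum
over elapsed time, is a supermartingale (`setLIntegral_potential_succ_le`). Stop it when the sum of
weights first reaches `L`. If some node is then uninformed, the potential is at least `exp(θ (L -
M)) F (n-1)`, where `M` bounds one weight. Hence lateness has probability at most `F 1 / F (n-1) ·
exp(-θ (L - M))` (`law_late_le`).

For `Φ ρ` the choice is `F k = (n-k)/k`, whose end ratio `(n-1)²` is beaten by `L = C log n`. For
`⌈Φ⌉ ρ̄` it is `F k = 2^(-k)` for `k < n`, whose end ratio `2^(n-2)` is beaten by `L = 2n`. -/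

open Classical in
/-- The probability that a call of `v` in `H` has exactly one end in `I`. -/
def crossProb {n : ℕ} (H : SimpleGraph (Fin n)) (I : Finset (Fin n)) (v : Fin n) : ℝ :=
  ∑ w, if H.Adj v w ∧ ¬(v ∈ I ↔ w ∈ I) then 1 / (H.degree v : ℝ) else 0

/-- The rate of the calls in `H` which have exactly one end in `I`. -/
def crossRate {n : ℕ} (H : SimpleGraph (Fin n)) (I : Finset (Fin n)) : ℝ :=
  ∑ v, crossProb H I v

section Graph

variable {n : ℕ} (H : SimpleGraph (Fin n)) (I : Finset (Fin n))

lemma crossProb_nonneg (v : Fin n) : 0 ≤ crossProb H I v := by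
  unfold crossProb
  exact Finset.sum_nonneg fun w _ => by split_ifs <;> positivity

lemma crossProb_le_one (v : Fin n) : crossProb H I v ≤ 1 := by
  classical
  unfold crossProb
  calc _ ≤ ∑ w, if w ∈ H.neighborFinset v then 1 / (H.degree v : ℝ) else 0 := by
        refine Finset.sum_le_sum fun w _ => ?_
        split_ifs with h1 h2 h2
        · exact le_rfl
        · exact absurd h1.1 (by simpa using h2)
        · positivity
        · exact le_rfl
    _ = (H.degree v : ℝ) * (1 / (H.degree v : ℝ)) := by
        rw [Finset.sum_ite_mem, Finset.univ_inter, Finset.sum_const, nsmul_eq_mul,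
          SimpleGraph.card_neighborFinset_eq_degree]
    _ ≤ 1 := by
        rw [mul_one_div]; exact div_self_le_one _

lemma crossRate_nonneg : 0 ≤ crossRate H I :=
  Finset.sum_nonneg fun v _ => crossProb_nonneg H I v

lemma crossRate_le : crossRate H I ≤ n := by
  calc crossRate H I ≤ ∑ _v : Fin n, (1 : ℝ) :=
        Finset.sum_le_sum fun v _ => crossProb_le_one H I v
    _ = n := by simp

-- A crossing edge is called from either of its ends, which is why both reciprocal degrees appear.
-- The sum over crossing edges is the form that conductance and diligence can bound.
open Classical in
lemma crossRate_eq : crossRate H I =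
    ∑ u ∈ I, ∑ w ∈ Iᶜ,
      if H.Adj u w then 1 / (H.degree u : ℝ) + 1 / (H.degree w : ℝ) else 0 := by
  have key : ∀ (v : Fin n) (S : Finset (Fin n)), (∀ w, w ∈ S ↔ ¬(v ∈ I ↔ w ∈ I)) →
      crossProb H I v = ∑ w ∈ S, if H.Adj v w then 1 / (H.degree v : ℝ) else 0 := by
    intro v S hS
    unfold crossProb
    rw [← Finset.univ_inter S, ← Finset.sum_ite_mem]
    refine Finset.sum_congr rfl fun w _ => ?_
    by_cases h : w ∈ S
    · simp [h, (hS w).1 h]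
    · have := (not_congr (hS w)).1 h
      simp only [this, and_false, if_false, h]
  unfold crossRate
  rw [← Finset.sum_add_sum_compl I]
  have h1 : ∑ v ∈ I, crossProb H I v =
      ∑ u ∈ I, ∑ w ∈ Iᶜ, if H.Adj u w then 1 / (H.degree u : ℝ) else 0 :=
    Finset.sum_congr rfl fun v hv => key v _ fun w => by simp [hv]
  have h2 : ∑ v ∈ Iᶜ, crossProb H I v =
      ∑ u ∈ I, ∑ w ∈ Iᶜ, if H.Adj u w then 1 / (H.degree w : ℝ) else 0 := by
    rw [Finset.sum_comm]
    refine Finset.sum_congr rfl fun v hv => ?_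
    rw [key v I fun w => by simp [Finset.mem_compl.1 hv]]
    exact Finset.sum_congr rfl fun w _ => by simp [H.adj_comm]
  rw [h1, h2, ← Finset.sum_add_distrib]
  refine Finset.sum_congr rfl fun u _ => ?_
  rw [← Finset.sum_add_distrib]
  exact Finset.sum_congr rfl fun w _ => by split_ifs <;> simp

lemma crossRate_compl : crossRate H Iᶜ = crossRate H I := by
  unfold crossRate crossProb
  refine Finset.sum_congr rfl fun v _ => Finset.sum_congr rfl fun w _ => ?_
  have h : (v ∈ Iᶜ ↔ w ∈ Iᶜ) ↔ (v ∈ I ↔ w ∈ I) := by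
    rw [Finset.mem_compl, Finset.mem_compl, not_iff_not]
  split_ifs with h1 h2 h2
  · rfl
  · exact absurd ⟨h1.1, fun h' => h1.2 (h.2 h')⟩ h2
  · exact absurd ⟨h2.1, fun h' => h2.2 (h.1 h')⟩ h1
  · rfl

lemma vol_nonneg : 0 ≤ vol H I := Finset.sum_nonneg fun _ _ => by positivity

lemma vol_add_vol_compl : vol H I + vol H Iᶜ = vol H Finset.univ :=
  Finset.sum_add_sum_compl _ _

lemma conductance_nonneg : 0 ≤ conductance H := by
  refine Real.sInf_nonneg ?_
  rintro x ⟨S, -, -, rfl⟩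
  exact div_nonneg (by unfold cutSize; positivity) (le_min (vol_nonneg _ _) (vol_nonneg _ _))

lemma cutDiligence_nonneg : 0 ≤ cutDiligence H I := by
  refine Real.sInf_nonneg ?_
  rintro x ⟨u, -, w, -, -, rfl⟩
  exact le_max_of_le_left (div_nonneg (div_nonneg (vol_nonneg _ _) (by positivity)) (by positivity))

lemma diligence_nonneg : 0 ≤ diligence H := by
  unfold diligence
  split_ifs
  · refine Real.sInf_nonneg ?_
    rintro x ⟨S, -, -, rfl⟩
    exact cutDiligence_nonneg H S
  · exact le_rfl

open Classical in
lemma cutDiligence_le {u w : Fin n} (hu : u ∈ I) (hw : w ∉ I) (h : H.Adj u w) :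
    cutDiligence H I ≤
      vol H I / I.card * (1 / (H.degree u : ℝ) + 1 / (H.degree w : ℝ)) := by
  have hv : 0 ≤ vol H I / (I.card : ℝ) := div_nonneg (vol_nonneg _ _) (by positivity)
  have h1 : cutDiligence H I ≤ max (vol H I / (I.card : ℝ) / (H.degree u : ℝ))
      (vol H I / (I.card : ℝ) / (H.degree w : ℝ)) := by
    refine csInf_le ⟨0, ?_⟩ ⟨u, hu, w, hw, h, rfl⟩
    rintro x ⟨u, -, w, -, -, rfl⟩
    exact le_max_of_le_left (div_nonneg hv (by positivity))
  · refine h1.trans ?_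
    rw [mul_add, mul_one_div, mul_one_div]
    exact max_le (le_add_of_nonneg_right (div_nonneg hv (by positivity)))
      (le_add_of_nonneg_left (div_nonneg hv (by positivity)))

lemma conductance_le (h1 : I.Nonempty) (h2 : I ≠ Finset.univ) :
    conductance H ≤ cutSize H I / min (vol H I) (vol H Iᶜ) := by
  refine csInf_le ⟨0, ?_⟩ ⟨I, h1, h2, rfl⟩
  rintro x ⟨S, -, -, rfl⟩
  exact div_nonneg (by unfold cutSize; positivity) (le_min (vol_nonneg _ _) (vol_nonneg _ _))

lemma diligence_le (hH : H.Connected) (h1 : 0 < vol H I)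
    (h2 : vol H I ≤ vol H Finset.univ / 2) : diligence H ≤ cutDiligence H I := by
  unfold diligence
  rw [if_pos hH]
  refine csInf_le ⟨0, ?_⟩ ⟨I, h1, h2, rfl⟩
  rintro x ⟨S, -, -, rfl⟩
  exact cutDiligence_nonneg H S

variable {H I}

lemma vol_pos (hH : H.Connected) (h1 : I.Nonempty) (h2 : I ≠ Finset.univ) : 0 < vol H I := by
  classical
  obtain ⟨u, hu⟩ := h1
  obtain ⟨w, hw⟩ : ∃ w, w ∉ I := by
    by_contra! h
    exact h2 (Finset.eq_univ_iff_forall.2 h)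
  have : Nontrivial (Fin n) := ⟨u, w, fun h => hw (h ▸ hu)⟩
  refine Finset.sum_pos' (fun _ _ => by positivity) ⟨u, hu, ?_⟩
  exact_mod_cast hH.preconnected.degree_pos_of_nontrivial u

/-- There are at least `Φ · vol I` crossing edges, and each contributes at least `ρ |I| / vol I` to
the rate, since a sum of two reciprocals dominates their maximum. The volumes cancel. -/
lemma conductance_mul_diligence_mul_card_le (hH : H.Connected) (h1 : I.Nonempty)
    (h2 : I ≠ Finset.univ) (h3 : vol H I ≤ vol H Finset.univ / 2) :
    conductance H * diligence H * I.card ≤ crossRate H I := by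
  classical
  have hv := vol_pos hH h1 h2
  have hc : (0 : ℝ) < I.card := by exact_mod_cast h1.card_pos
  have h4 : conductance H * vol H I ≤ cutSize H I := by
    have := conductance_le H I h1 h2
    rw [min_eq_left (by linarith [vol_add_vol_compl H I])] at this
    exact (le_div_iff₀ hv).1 this
  have h5 : cutSize H I * (diligence H / (vol H I / I.card)) ≤ crossRate H I := by
    rw [crossRate_eq, ← Finset.sum_product']
    have : cutSize H I = ((((I ×ˢ Iᶜ).filter fun p => H.Adj p.1 p.2).card : ℕ) : ℝ) := by
      unfold cutSize SimpleGraph.interedges Rel.interedges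
      congr!
    rw [this, ← nsmul_eq_mul, ← Finset.sum_const, Finset.sum_filter]
    refine Finset.sum_le_sum fun p hp => ?_
    rw [Finset.mem_product, Finset.mem_compl] at hp
    split_ifs with h
    · rw [div_le_iff₀' (by positivity)]
      exact (diligence_le H I hH hv h3).trans (cutDiligence_le H I hp.1 hp.2 h)
    · exact le_rfl
  refine le_trans ?_ h5
  calc conductance H * diligence H * I.card
      = (conductance H * vol H I) * (diligence H / (vol H I / I.card)) := by
        field_simp
    _ ≤ _ := mul_le_mul_of_nonneg_right h4 (div_nonneg (diligence_nonneg H) (by positivity))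

lemma conductance_mul_diligence_nonneg (H : SimpleGraph (Fin n)) :
    0 ≤ conductance H * diligence H :=
  mul_nonneg (conductance_nonneg H) (diligence_nonneg H)

/-- The previous bound applies to whichever side has the smaller volume. That side need not be the
one with fewer nodes, hence the minimum. -/
lemma conductance_mul_diligence_mul_min_le (h1 : I.Nonempty) (h2 : I ≠ Finset.univ) :
    conductance H * diligence H * min (I.card : ℝ) (n - I.card) ≤ crossRate H I := by
  by_cases hH : H.Connected
  · have h0 := conductance_mul_diligence_nonneg H
    rcases le_total (vol H I) (vol H Finset.univ / 2) with h | h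
    · exact (mul_le_mul_of_nonneg_left (min_le_left _ _) h0).trans
        (conductance_mul_diligence_mul_card_le hH h1 h2 h)
    · have hc : (n : ℝ) - I.card = (Iᶜ.card : ℝ) := by
        rw [Finset.card_compl, Fintype.card_fin, Nat.cast_sub]
        simpa using I.card_le_univ
      rw [← crossRate_compl, hc]
      refine (mul_le_mul_of_nonneg_left (min_le_right _ _) h0).trans
        (conductance_mul_diligence_mul_card_le hH ?_ ?_ ?_)
      · rwa [Finset.nonempty_iff_ne_empty, Ne, Finset.compl_eq_empty_iff]
      · rw [Ne, Finset.compl_eq_univ_iff]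
        exact h1.ne_empty
      · linarith [vol_add_vol_compl H I]
  · simp only [diligence, if_neg hH, mul_zero, zero_mul]
    exact crossRate_nonneg H I

/-- Cut off one vertex `u` of minimum degree: each of its `d_u` edges has rate at most `2/d_u`. This
caps the overshoot when the sum of weights passes its target. -/
lemma conductance_mul_diligence_le_two (hn : 2 ≤ n) (H : SimpleGraph (Fin n)) :
    conductance H * diligence H ≤ 2 := by
  classical
  have : Nonempty (Fin n) := ⟨⟨0, by omega⟩⟩
  obtain ⟨u, hu⟩ := Finite.exists_min (fun u => H.degree u)
  have hu1 : ({u} : Finset (Fin n)) ≠ Finset.univ := by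
    intro h
    have := congrArg Finset.card h
    simp at this
    omega
  have h := conductance_mul_diligence_mul_min_le (H := H) (Finset.singleton_nonempty u) hu1
  have h2 : (2 : ℝ) ≤ n := by exact_mod_cast hn
  rw [Finset.card_singleton, Nat.cast_one, min_eq_left (by linarith), mul_one] at h
  refine h.trans ?_
  rw [crossRate_eq, Finset.sum_singleton]
  rcases Nat.eq_zero_or_pos (H.degree u) with h0 | h0
  · rw [Finset.sum_eq_zero]
    · norm_num
    · intro w _
      rw [if_neg]
      intro hw
      have : 0 < H.degree u := (H.degree_pos_iff_exists_adj u).2 ⟨w, hw⟩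
      omega
  · have hd : (0 : ℝ) < H.degree u := by exact_mod_cast h0
    calc _ ≤ ∑ w, if w ∈ H.neighborFinset u then 2 / (H.degree u : ℝ) else 0 := by
          refine (Finset.sum_le_univ_sum_of_nonneg fun w => by split_ifs <;> positivity).trans ?_
          refine Finset.sum_le_sum fun w _ => ?_
          simp only [SimpleGraph.mem_neighborFinset]
          split_ifs
          · have : (H.degree u : ℝ) ≤ H.degree w := by exact_mod_cast hu w
            have := one_div_le_one_div_of_le hd this
            calc _ ≤ 1 / (H.degree u : ℝ) + 1 / (H.degree u : ℝ) := by linarith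
              _ = _ := by ring
          · exact le_rfl
      _ = (H.degree u : ℝ) * (2 / (H.degree u : ℝ)) := by
          rw [Finset.sum_ite_mem, Finset.univ_inter, Finset.sum_const, nsmul_eq_mul,
            SimpleGraph.card_neighborFinset_eq_degree]
      _ = 2 := by field_simp
      _ ≤ 2 := le_rfl

lemma absDiligence_nonneg (H : SimpleGraph (Fin n)) : 0 ≤ absDiligence H := by
  refine Real.sInf_nonneg ?_
  rintro x ⟨u, w, -, rfl⟩
  exact le_max_of_le_left (by positivity)

open Classical in
lemma absDiligence_le {u w : Fin n} (h : H.Adj u w) :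
    absDiligence H ≤ max (1 / (H.degree u : ℝ)) (1 / (H.degree w : ℝ)) := by
  refine csInf_le ⟨0, ?_⟩ ⟨u, w, h, rfl⟩
  rintro x ⟨u, w, -, rfl⟩
  exact le_max_of_le_left (by positivity)

lemma absDiligence_le_one (H : SimpleGraph (Fin n)) : absDiligence H ≤ 1 := by
  classical
  by_cases h : ∃ u w, H.Adj u w
  · obtain ⟨u, w, h⟩ := h
    refine (absDiligence_le h).trans (max_le ?_ ?_)
    · simpa using Nat.cast_inv_le_one (H.degree u)
    · simpa using Nat.cast_inv_le_one (H.degree w)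
  · have : absDiligence H = 0 := by
      unfold absDiligence
      convert Real.sInf_empty
      refine Set.eq_empty_iff_forall_notMem.2 ?_
      rintro x ⟨u, w, h', -⟩
      exact h ⟨u, w, h'⟩
    rw [this]; exact zero_le_one

lemma ceilConductance_mul_absDiligence_nonneg (H : SimpleGraph (Fin n)) :
    0 ≤ ceilConductance H * absDiligence H := by
  refine mul_nonneg ?_ (absDiligence_nonneg H)
  unfold ceilConductance
  split_ifs <;> norm_num

lemma ceilConductance_mul_absDiligence_le_one (H : SimpleGraph (Fin n)) :
    ceilConductance H * absDiligence H ≤ 1 := by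
  unfold ceilConductance
  split_ifs
  · simpa using absDiligence_le_one H
  · simp

/-- A walk from `I` to its complement must use a crossing edge, and one such edge is enough. -/
lemma ceilConductance_mul_absDiligence_le (h1 : I.Nonempty) (h2 : I ≠ Finset.univ) :
    ceilConductance H * absDiligence H ≤ crossRate H I := by
  classical
  unfold ceilConductance
  split_ifs with hH
  · obtain ⟨a, ha⟩ := h1
    obtain ⟨b, hb⟩ : ∃ w, w ∉ I := by
      by_contra! h
      exact h2 (Finset.eq_univ_iff_forall.2 h)
    obtain ⟨p⟩ := hH.preconnected a b
    obtain ⟨d, -, hd1, hd2⟩ := p.exists_boundary_dart (I : Set (Fin n)) (by simpa using ha)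
      (by simpa using hb)
    rw [one_mul, crossRate_eq]
    have hpos : ∀ u w : Fin n, 0 ≤ if H.Adj u w then
        1 / (H.degree u : ℝ) + 1 / (H.degree w : ℝ) else 0 := by
      intro u w; split_ifs <;> positivity
    calc absDiligence H
        ≤ 1 / (H.degree d.fst : ℝ) + 1 / (H.degree d.snd : ℝ) :=
          (absDiligence_le d.adj).trans (max_le (le_add_of_nonneg_right (by positivity))
            (le_add_of_nonneg_left (by positivity)))
      _ = if H.Adj d.fst d.snd then
            1 / (H.degree d.fst : ℝ) + 1 / (H.degree d.snd : ℝ) else 0 := by rw [if_pos d.adj]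
      _ ≤ ∑ w ∈ Iᶜ, if H.Adj d.fst w then
            1 / (H.degree d.fst : ℝ) + 1 / (H.degree w : ℝ) else 0 :=
          Finset.single_le_sum (f := fun w => if H.Adj d.fst w then
            1 / (H.degree d.fst : ℝ) + 1 / (H.degree w : ℝ) else 0)
            (fun w _ => hpos d.fst w) (by simpa using hd2)
      _ ≤ _ := Finset.single_le_sum (f := fun u => ∑ w ∈ Iᶜ, if H.Adj u w then
            1 / (H.degree u : ℝ) + 1 / (H.degree w : ℝ) else 0)
            (fun u _ => Finset.sum_nonneg fun w _ => hpos u w) (by simpa using hd1)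
  · simpa using crossRate_nonneg H I

end Graph

/-! ### The law of a single waiting time and choice -/

lemma expMeasure_Ioi {a : ℝ} (ha : 0 ≤ a) :
    expMeasure 1 (Set.Ioi a) = ENNReal.ofReal (Real.exp (-a)) := by
  rw [← Set.compl_Iic, prob_compl_eq_one_sub measurableSet_Iic, ← ofReal_cdf,
    cdf_expMeasure_eq one_pos, if_pos ha, ← ENNReal.ofReal_one,
    ← ENNReal.ofReal_sub _ (by simpa using ha)]
  simp

lemma expMeasure_Ici {a : ℝ} (ha : 0 ≤ a) :
    expMeasure 1 (Set.Ici a) = ENNReal.ofReal (Real.exp (-a)) := by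
  have h : expMeasure 1 {a} = 0 := by
    unfold expMeasure gammaMeasure
    exact withDensity_absolutelyContinuous _ _ Real.volume_singleton
  refine le_antisymm ?_ ((expMeasure_Ioi ha).symm.le.trans
    (measure_mono Set.Ioi_subset_Ici_self))
  rw [← Set.Ioi_insert, Set.insert_eq]
  exact (measure_union_le _ _).trans (by rw [h, zero_add, expMeasure_Ioi ha])

lemma expMeasure_Ioo {a b : ℝ} (ha : 0 ≤ a) (hab : a ≤ b) :
    expMeasure 1 (Set.Ioo a b) = ENNReal.ofReal (Real.exp (-a) - Real.exp (-b)) := by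
  have h : Set.Ioo a b = Set.Ioi a \ Set.Ici b := by
    ext x; simp
  rcases hab.eq_or_lt with rfl | hab
  · simp
  rw [h, measure_sdiff (Set.Ici_subset_Ioi.2 hab) measurableSet_Ici.nullMeasurableSet
    (measure_ne_top _ _), expMeasure_Ioi ha, expMeasure_Ici (ha.trans hab.le),
    ENNReal.ofReal_sub _ (Real.exp_nonneg _)]

/-- The neighbours of `v` in `H` which lie on the other side of the cut `(I, Iᶜ)`. -/
def crossSet {n : ℕ} (H : SimpleGraph (Fin n)) (I : Finset (Fin n)) (v : Fin n) :
    Set (Fin n) :=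
  {w | H.Adj v w ∧ ¬(v ∈ I ↔ w ∈ I)}

lemma neighborLaw_crossSet {n : ℕ} (H : SimpleGraph (Fin n)) (I : Finset (Fin n)) (v : Fin n) :
    neighborLaw v H (crossSet H I v) = ENNReal.ofReal (crossProb H I v) := by
  classical
  have hsum : crossProb H I v =
      ((H.neighborFinset v ∩ (crossSet H I v).toFinset).card : ℝ) / (H.degree v : ℝ) := by
    unfold crossProb
    rw [← Finset.sum_filter, Finset.sum_const, nsmul_eq_mul, mul_one_div]
    congr 3
    ext w
    have hw : w ∈ crossSet H I v ↔ H.Adj v w ∧ ¬(v ∈ I ↔ w ∈ I) := Iff.rfl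
    simp only [Finset.mem_filter, Finset.mem_univ, true_and, Finset.mem_inter,
      SimpleGraph.mem_neighborFinset, Set.mem_toFinset, hw]
    tauto
  unfold neighborLaw
  split_ifs with h
  · have hd : 0 < H.degree v := (H.degree_pos_iff_exists_adj v).2 h
    have h1 : H.neighborSet v = (H.neighborFinset v : Set (Fin n)) := by simp
    have h2 : crossSet H I v = ((crossSet H I v).toFinset : Set (Fin n)) := by simp
    rw [h1, h2, uniformOn_apply_finset, hsum, ENNReal.ofReal_div_of_pos (by exact_mod_cast hd),
      ENNReal.ofReal_natCast, ENNReal.ofReal_natCast, SimpleGraph.card_neighborFinset_eq_degree]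
  · have h3 : ∀ w, ¬ H.Adj v w := fun w hw => h ⟨w, hw⟩
    rw [Measure.dirac_apply' _ (Set.toFinite _).measurableSet, Set.indicator_of_notMem]
    · simp [crossProb, h3]
    · simp [crossSet]

/-- The law of a waiting time of `v` and the corresponding choices. -/
def tickLaw {n : ℕ} (v : Fin n) : Measure (ℝ × (SimpleGraph (Fin n) → Fin n)) :=
  (expMeasure 1).prod (Measure.pi fun H : SimpleGraph (Fin n) => neighborLaw v H)

instance {n : ℕ} (v : Fin n) : IsProbabilityMeasure (tickLaw v) := by
  unfold tickLaw; infer_instance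

lemma tickLaw_lt {n : ℕ} (v : Fin n) {a : ℝ} (ha : 0 ≤ a) :
    tickLaw v {x | a < x.1} = ENNReal.ofReal (Real.exp (-a)) := by
  have : {x : ℝ × (SimpleGraph (Fin n) → Fin n) | a < x.1} = Set.Ioi a ×ˢ Set.univ := by
    ext x; simp
  rw [this, tickLaw, Measure.prod_prod, measure_univ, mul_one, expMeasure_Ioi ha]

/-- Once the waiting time exceeds `a`, its remainder is again exponential: it ends within `δ` with
probability `1 - exp (-δ)`, and the independent choice then crosses with probability `crossProb H I
v`. Only one tick is examined, which suffices for an upper bound. -/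
lemma tickLaw_noCross {n : ℕ} (H : SimpleGraph (Fin n)) (I : Finset (Fin n)) (v : Fin n)
    {a δ : ℝ} (ha : 0 ≤ a) (hδ : 0 ≤ δ) :
    tickLaw v {x | a < x.1 ∧ (x.1 < a + δ → x.2 H ∉ crossSet H I v)} ≤
      ENNReal.ofReal (1 - (1 - Real.exp (-δ)) * crossProb H I v) * tickLaw v {x | a < x.1} := by
  have hp0 := crossProb_nonneg H I v
  have hp1 := crossProb_le_one H I v
  have he : Real.exp (-δ) ≤ 1 := by simpa using hδ
  have hchoice : Measure.pi (fun H : SimpleGraph (Fin n) => neighborLaw v H)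
      {c | c H ∉ crossSet H I v} = ENNReal.ofReal (1 - crossProb H I v) := by
    have h : {c : SimpleGraph (Fin n) → Fin n | c H ∉ crossSet H I v} =
        Function.eval H ⁻¹' (crossSet H I v)ᶜ := rfl
    rw [h, (measurePreserving_eval (fun H : SimpleGraph (Fin n) => neighborLaw v H)
      H).measure_preimage (Set.toFinite _).measurableSet.nullMeasurableSet,
      prob_compl_eq_one_sub (Set.toFinite _).measurableSet, neighborLaw_crossSet,
      ENNReal.ofReal_sub _ hp0, ENNReal.ofReal_one]
  have hsub : {x : ℝ × (SimpleGraph (Fin n) → Fin n) |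
      a < x.1 ∧ (x.1 < a + δ → x.2 H ∉ crossSet H I v)} ⊆
      Set.Ioo a (a + δ) ×ˢ {c | c H ∉ crossSet H I v} ∪ Set.Ici (a + δ) ×ˢ Set.univ := by
    rintro x ⟨h1, h2⟩
    rcases lt_or_ge x.1 (a + δ) with h | h
    · exact Or.inl ⟨⟨h1, h⟩, h2 h⟩
    · exact Or.inr ⟨h, trivial⟩
  refine (measure_mono hsub).trans ((measure_union_le _ _).trans ?_)
  rw [tickLaw_lt v ha, tickLaw, Measure.prod_prod, Measure.prod_prod, hchoice, measure_univ, mul_one,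
    expMeasure_Ioo ha (by linarith), expMeasure_Ici (by linarith), neg_add, Real.exp_add,
    ← ENNReal.ofReal_mul' (by linarith), ← ENNReal.ofReal_add, ← ENNReal.ofReal_mul]
  · exact ENNReal.ofReal_le_ofReal (by ring_nf; rfl)
  · nlinarith [Real.exp_nonneg (-δ)]
  · refine mul_nonneg ?_ (by linarith)
    nlinarith [Real.exp_nonneg (-a)]
  · positivity

/-! ### The clocks after a fixed time -/

section Clocks

variable {n : ℕ}

/-- All waiting times are positive. -/
def PosWait (ω : Outcome n) : Prop := ∀ i, 0 < (ω i).1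

lemma law_eq (n : ℕ) : law n = Measure.infinitePi fun i : Fin n × ℕ => tickLaw i.1 := rfl

instance (n : ℕ) : IsProbabilityMeasure (law n) := by
  rw [law_eq]; infer_instance

lemma measurable_tickTime (v : Fin n) (k : ℕ) : Measurable fun ω : Outcome n => tickTime ω v k := by
  unfold tickTime
  fun_prop

lemma ae_posWait : ∀ᵐ ω ∂law n, PosWait ω := by
  refine ae_all_iff.2 fun i => ?_
  have h : MeasurableSet {x : ℝ × (SimpleGraph (Fin n) → Fin n) | 0 < x.1} :=
    measurableSet_lt measurable_const measurable_fst
  have h1 : ∀ᵐ x ∂tickLaw i.1, 0 < x.1 := by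
    rw [ae_iff]
    refine (prob_compl_eq_zero_iff h).2 ?_
    rw [tickLaw_lt _ le_rfl]; simp
  exact (measurePreserving_eval_infinitePi (fun i : Fin n × ℕ => tickLaw i.1)
    i).quasiMeasurePreserving.ae h1

lemma PosWait.le_tickTime {ω : Outcome n} (hω : PosWait ω) (v : Fin n) {i k : ℕ} (h : i ≤ k) :
    (ω (v, i)).1 ≤ tickTime ω v k :=
  Finset.single_le_sum (f := fun i => (ω (v, i)).1) (fun _ _ => (hω _).le) (by simp; omega)

lemma PosWait.tickTime_mono {ω : Outcome n} (hω : PosWait ω) (v : Fin n) :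
    Monotone (tickTime ω v) := fun _ _ h =>
  Finset.sum_le_sum_of_subset_of_nonneg (Finset.range_mono (by omega)) fun _ _ _ => (hω _).le

/-- Among infinitely many independent waits, almost surely one alone exceeds `s`, so the clocks do
not explode. -/
lemma ae_exists_lt_tickTime {s : ℝ} (hs : 0 ≤ s) :
    ∀ᵐ ω ∂law n, ∀ v, ∃ k, s < tickTime ω v k := by
  have hm : ∀ v : Fin n, law n {ω | ∀ i : ℕ, (ω (v, i)).1 ≤ s} = 0 := by
    intro v
    have hr : tickLaw v {x : ℝ × (SimpleGraph (Fin n) → Fin n) | x.1 ≤ s} < 1 := by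
      have h : {x : ℝ × (SimpleGraph (Fin n) → Fin n) | x.1 ≤ s} = {x | s < x.1}ᶜ := by
        ext x; simp
      rw [h, prob_compl_eq_one_sub (measurableSet_lt measurable_const measurable_fst),
        tickLaw_lt v hs]
      exact ENNReal.sub_lt_self (by simp) (by simp) (by simp [Real.exp_pos])
    refine le_antisymm (ge_of_tendsto'
      (ENNReal.tendsto_pow_atTop_nhds_zero_of_lt_one hr) fun m => ?_) (zero_le)
    have hpi := Measure.infinitePi_pi (fun i : Fin n × ℕ => tickLaw i.1)
      (s := (Finset.range m).map ⟨fun i => (v, i), fun i j h => (Prod.mk.inj h).2⟩)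
      (t := fun _ => {x | x.1 ≤ s}) (fun _ _ => measurableSet_le measurable_fst measurable_const)
    rw [← law_eq] at hpi
    refine (measure_mono fun ω hω => ?_).trans (hpi.trans ?_).le
    swap
    · rw [Finset.prod_map]
      change ∏ _i ∈ Finset.range m, tickLaw v {x | x.1 ≤ s} = _
      rw [Finset.prod_const, Finset.card_range]
    intro i hi
    obtain ⟨j, -, rfl⟩ := Finset.mem_map.1 (Finset.mem_coe.1 hi)
    exact hω j
  have h2 : ∀ᵐ ω ∂law n, ∀ v, ∃ i : ℕ, s < (ω (v, i)).1 := by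
    refine ae_all_iff.2 fun v => ?_
    rw [ae_iff]
    simpa using hm v
  filter_upwards [h2, ae_posWait] with ω h1 hω v
  obtain ⟨i, hi⟩ := h1 v
  exact ⟨i, hi.trans_le (hω.le_tickTime v le_rfl)⟩

/-- The outcome `ω` with the clock of each node `v` replaced by a fixed one from the tick number
`K v` on; this tick then comes after time `s`. -/
def truncate (s : ℝ) (K : Fin n → ℕ) (ω : Outcome n) : Outcome n :=
  fun i => if i.2 < K i.1 then ω i else (s + 1, fun _ => i.1)

/-- The waiting time and the choices of each node `v` at the tick number `K v`. -/
def nextTick (K : Fin n → ℕ) (ω : Outcome n) (v : Fin n) : ℝ × (SimpleGraph (Fin n) → Fin n) :=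
  ω (v, K v)

lemma measurable_truncate (s : ℝ) (K : Fin n → ℕ) : Measurable (truncate s K) := by
  refine measurable_pi_iff.2 fun i => ?_
  unfold truncate
  split_ifs
  · exact measurable_pi_apply i
  · exact measurable_const

lemma measurable_nextTick (K : Fin n → ℕ) : Measurable (nextTick K) :=
  measurable_pi_iff.2 fun v => measurable_pi_apply (v, K v)

/-- The two maps read disjoint finite sets of coordinates: the indices below `K v`, and the indices
equal to `K v`. -/
lemma indepFun_truncate_nextTick (s : ℝ) (K : Fin n → ℕ) :
    IndepFun (truncate s K) (nextTick K) (law n) := by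
  classical
  have h := iIndepFun_infinitePi (P := fun i : Fin n × ℕ => tickLaw i.1) (X := fun _ x => x)
    (fun _ => measurable_id)
  let S : Finset (Fin n × ℕ) :=
    Finset.univ.biUnion fun v => (Finset.range (K v)).image fun i => (v, i)
  let T : Finset (Fin n × ℕ) := Finset.univ.image fun v => (v, K v)
  have hS : ∀ i : Fin n × ℕ, i.2 < K i.1 → i ∈ S := by
    rintro ⟨v, i⟩ hi
    simpa [S] using hi
  have hT : ∀ v : Fin n, (v, K v) ∈ T := fun v => Finset.mem_image_of_mem _ (Finset.mem_univ v)
  have hST : Disjoint S T := by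
    rw [Finset.disjoint_left]
    rintro ⟨v, i⟩ h1 h2
    simp only [S, T, Finset.mem_biUnion, Finset.mem_univ, true_and, Finset.mem_image,
      Finset.mem_range, Prod.mk.injEq] at h1 h2
    obtain ⟨a, b, h1, rfl, rfl⟩ := h1
    obtain ⟨c, rfl, h2⟩ := h2
    omega
  have hi := h.indepFun_finset S T hST (fun i => measurable_pi_apply i)
  have h1 : truncate s K = (fun (x : ∀ _ : S, ℝ × (SimpleGraph (Fin n) → Fin n)) i =>
      if hi : i.2 < K i.1 then x ⟨i, hS i hi⟩ else (s + 1, fun _ => i.1)) ∘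
      fun (ω : Outcome n) (i : S) => ω i := by
    funext ω i
    simp only [truncate, Function.comp]
    split_ifs <;> rfl
  have h2 : nextTick K = (fun (x : ∀ _ : T, ℝ × (SimpleGraph (Fin n) → Fin n)) v =>
      x ⟨(v, K v), hT v⟩) ∘ fun (ω : Outcome n) (i : T) => ω i := rfl
  rw [h1, h2, law_eq]
  refine hi.comp ?_ ?_
  · refine measurable_pi_iff.2 fun i => ?_
    split_ifs
    · exact measurable_pi_apply _
    · exact measurable_const
  · exact measurable_pi_iff.2 fun v => measurable_pi_apply _

lemma map_nextTick (K : Fin n → ℕ) :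
    (law n).map (nextTick K) = Measure.pi fun v => tickLaw v := by
  have h := Measure.map_infinitePi_infinitePi_of_inj (P := fun i : Fin n × ℕ => tickLaw i.1)
    (f := fun v : Fin n => (v, K v)) (fun v w h => (Prod.mk.inj h).1)
  exact h.trans (Measure.infinitePi_eq_pi _)

/-- Fubini for the independent pair (past, next ticks): the next ticks are integrated out with the
past held fixed. -/
lemma lintegral_truncate_nextTick (s : ℝ) (K : Fin n → ℕ) {G : Outcome n → ℝ≥0∞}
    (hG : Measurable G) {D : Set (Outcome n × (Fin n → ℝ × (SimpleGraph (Fin n) → Fin n)))}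
    (hD : MeasurableSet D) :
    ∫⁻ ω, G (truncate s K ω) * D.indicator 1 (truncate s K ω, nextTick K ω) ∂law n =
      ∫⁻ x, G x * Measure.pi (fun v => tickLaw v) (Prod.mk x ⁻¹' D)
        ∂((law n).map (truncate s K)) := by
  have hF : Measurable fun p : Outcome n × (Fin n → ℝ × (SimpleGraph (Fin n) → Fin n)) =>
      G p.1 * D.indicator 1 p :=
    (hG.comp measurable_fst).mul (measurable_one.indicator hD)
  have : IsProbabilityMeasure ((law n).map (truncate s K)) :=
    Measure.isProbabilityMeasure_map (measurable_truncate s K).aemeasurable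
  have hmap := (indepFun_iff_map_prod_eq_prod_map_map (measurable_truncate s K).aemeasurable
    (measurable_nextTick K).aemeasurable).1 (indepFun_truncate_nextTick s K)
  rw [map_nextTick] at hmap
  rw [← lintegral_map (f := fun p : Outcome n × (Fin n → ℝ × (SimpleGraph (Fin n) → Fin n)) =>
      G p.1 * D.indicator 1 p) hF ((measurable_truncate s K).prodMk (measurable_nextTick K)),
    hmap, lintegral_prod _ hF.aemeasurable]
  refine lintegral_congr fun x => ?_
  rw [← lintegral_indicator_one (measurable_prodMk_left hD), ← lintegral_const_mul]
  · rfl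
  · exact measurable_one.indicator (measurable_prodMk_left hD)

end Clocks

/-- A waiting time and the choices at the tick that ends it. -/
abbrev Tick (n : ℕ) : Type := ℝ × (SimpleGraph (Fin n) → Fin n)

/-! ### The Markov property at a fixed time -/

section Memoryless

variable {n : ℕ}

/-- The clock of each node `v` has ticked exactly `K v` times up to time `s`. -/
def tickCounts (s : ℝ) (K : Fin n → ℕ) : Set (Outcome n) :=
  {ω | ∀ v, (∀ i < K v, tickTime ω v i ≤ s) ∧ s < tickTime ω v (K v)}

/-- In the open interval `(s, t)` no call in `H` has exactly one end in `I`. -/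
def noCross (H : SimpleGraph (Fin n)) (I : Finset (Fin n)) (s t : ℝ) : Set (Outcome n) :=
  {ω | ∀ v k, s < tickTime ω v k → tickTime ω v k < t → (ω (v, k)).2 H ∉ crossSet H I v}

/-- The time that has passed at time `s` since the tick of `v` before the tick number `K v`. -/
def elapsed (s : ℝ) (K : Fin n → ℕ) (ω : Outcome n) (v : Fin n) : ℝ :=
  s - ∑ i ∈ Finset.range (K v), (ω (v, i)).1

lemma measurable_elapsed (s : ℝ) (K : Fin n → ℕ) (v : Fin n) :
    Measurable fun ω => elapsed s K ω v := by
  unfold elapsed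
  fun_prop

lemma measurableSet_choice (H : SimpleGraph (Fin n)) (i : Fin n × ℕ) (A : Set (Fin n)) :
    MeasurableSet {ω : Outcome n | (ω i).2 H ∈ A} := by
  have : Measurable fun ω : Outcome n => (ω i).2 H := by fun_prop
  exact this (Set.toFinite A).measurableSet

lemma measurableSet_tickCounts (s : ℝ) (K : Fin n → ℕ) : MeasurableSet (tickCounts s K) := by
  refine measurableSet_setOfPred.2 (Measurable.forall fun v => (Measurable.forall fun i =>
    Measurable.forall fun _ => ?_).and ?_)
  · exact measurableSet_setOfPred.1 (measurableSet_le (measurable_tickTime v i) measurable_const)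
  · exact measurableSet_setOfPred.1 (measurableSet_lt measurable_const (measurable_tickTime v _))

lemma measurableSet_noCross (H : SimpleGraph (Fin n)) (I : Finset (Fin n)) (s t : ℝ) :
    MeasurableSet (noCross H I s t) := by
  refine measurableSet_setOfPred.2 (Measurable.forall fun v => Measurable.forall fun k =>
    Measurable.imp ?_ (Measurable.imp ?_ (Measurable.not ?_)))
  · exact measurableSet_setOfPred.1 (measurableSet_lt measurable_const (measurable_tickTime v k))
  · exact measurableSet_setOfPred.1 (measurableSet_lt (measurable_tickTime v k) measurable_const)
  · exact measurableSet_setOfPred.1 (measurableSet_choice H (v, k) _)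

lemma truncate_apply {s : ℝ} {K : Fin n → ℕ} (ω : Outcome n) {v : Fin n} {i : ℕ} (hi : i < K v) :
    truncate s K ω (v, i) = ω (v, i) := if_pos hi

lemma tickTime_truncate {s : ℝ} {K : Fin n → ℕ} (ω : Outcome n) {v : Fin n} {i : ℕ}
    (hi : i < K v) : tickTime (truncate s K ω) v i = tickTime ω v i := by
  refine Finset.sum_congr rfl fun j hj => ?_
  rw [truncate_apply ω (by rw [Finset.mem_range] at hj; omega)]

lemma elapsed_truncate {s : ℝ} {K : Fin n → ℕ} (ω : Outcome n) (v : Fin n) :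
    elapsed s K (truncate s K ω) v = elapsed s K ω v := by
  unfold elapsed
  congr 1
  exact Finset.sum_congr rfl fun j hj => by rw [truncate_apply ω (Finset.mem_range.1 hj)]

lemma elapsed_lt_iff {s : ℝ} {K : Fin n → ℕ} (ω : Outcome n) (v : Fin n) (δ : ℝ) :
    elapsed s K ω v + δ < (nextTick K ω v).1 ↔ s + δ < tickTime ω v (K v) := by
  unfold elapsed nextTick tickTime
  rw [Finset.sum_range_succ]
  constructor <;> intro h <;> linarith

lemma lt_elapsed_iff {s : ℝ} {K : Fin n → ℕ} (ω : Outcome n) (v : Fin n) (δ : ℝ) :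
    (nextTick K ω v).1 < elapsed s K ω v + δ ↔ tickTime ω v (K v) < s + δ := by
  unfold elapsed nextTick tickTime
  rw [Finset.sum_range_succ]
  constructor <;> intro h <;> linarith

lemma elapsed_nonneg {s : ℝ} (hs : 0 ≤ s) {K : Fin n → ℕ} {ω : Outcome n} {v : Fin n}
    (h : ∀ i < K v, tickTime ω v i ≤ s) : 0 ≤ elapsed s K ω v := by
  unfold elapsed
  rcases hK : K v with _ | k
  · simpa using hs
  · exact sub_nonneg.2 (h k (by omega))

lemma PosWait.truncate {ω : Outcome n} (hω : PosWait ω) {s : ℝ} (hs : 0 ≤ s) (K : Fin n → ℕ) :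
    PosWait (truncate s K ω) := by
  intro i
  unfold RumorSpreading.truncate
  split_ifs
  · exact hω i
  · change 0 < s + 1
    linarith

/-- The replacement wait `s + 1` pushes every replaced tick beyond `s`. A quantity known at `s` can
thus be evaluated at the truncation, which is independent of the next ticks. -/
lemma agreeUpTo_truncate {ω : Outcome n} (hω : PosWait ω) {s : ℝ} (hs : 0 ≤ s) {K : Fin n → ℕ}
    (hK : ω ∈ tickCounts s K) : AgreeUpTo s ω (truncate s K ω) := by
  rintro v k h
  by_cases hk : k < K v
  · exact (truncate_apply ω hk).symm
  · exfalso
    rw [not_lt] at hk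
    rcases h with h | h
    · exact absurd ((hK v).2.trans_le (hω.tickTime_mono v hk)) (not_lt.2 h)
    · have h1 := (hω.truncate hs K).le_tickTime v (le_refl k)
      have h2 : (truncate s K ω (v, k)).1 = s + 1 := by
        unfold truncate
        rw [if_neg (not_lt.2 hk)]
      linarith

/-- A function of the outcome which depends only on what has happened up to time `s`, as long as
the waiting times are positive. -/
def KnownAt {α : Type*} (s : ℝ) (g : Outcome n → α) : Prop :=
  ∀ ω ω', PosWait ω → PosWait ω' → AgreeUpTo s ω ω' → g ω = g ω'

lemma prod_ofReal_one_sub_le (H : SimpleGraph (Fin n)) (I : Finset (Fin n)) (c : ℝ) :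
    ∏ v, ENNReal.ofReal (1 - c * crossProb H I v) ≤
      ENNReal.ofReal (Real.exp (-(c * crossRate H I))) := by
  calc ∏ v, ENNReal.ofReal (1 - c * crossProb H I v)
      ≤ ∏ v, ENNReal.ofReal (Real.exp (-(c * crossProb H I v))) :=
        Finset.prod_le_prod' fun v _ => ENNReal.ofReal_le_ofReal (by
          linarith [Real.add_one_le_exp (-(c * crossProb H I v))])
    _ = _ := by
        rw [← ENNReal.ofReal_prod_of_nonneg fun _ _ => (Real.exp_nonneg _), ← Real.exp_sum,
          Finset.sum_neg_distrib, crossRate, Finset.mul_sum]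

lemma setLIntegral_tickCounts_noCross_le {s δ : ℝ} (hs : 0 ≤ s) (hδ : 0 ≤ δ)
    (H : SimpleGraph (Fin n)) (I : Finset (Fin n)) {g : Outcome n → ℝ≥0∞} (hg : Measurable g)
    (hgs : KnownAt s g) (K : Fin n → ℕ) :
    ∫⁻ ω in tickCounts s K ∩ noCross H I s (s + δ), g ω ∂law n ≤
      ENNReal.ofReal (Real.exp (-((1 - Real.exp (-δ)) * crossRate H I))) *
        ∫⁻ ω in tickCounts s K, g ω ∂law n := by
  let P : Set (Outcome n) := {x | ∀ v, ∀ i < K v, tickTime x v i ≤ s}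
  let U : Set (Outcome n × (Fin n → Tick n)) := {p | ∀ v, elapsed s K p.1 v < (p.2 v).1}
  -- `U` says that each next tick falls after `s`. `D` adds that it does not cross before `s + δ`,
  -- and ignores all later ticks.
  let D : Set (Outcome n × (Fin n → Tick n)) := {p | ∀ v, elapsed s K p.1 v < (p.2 v).1 ∧
    ((p.2 v).1 < elapsed s K p.1 v + δ → (p.2 v).2 H ∉ crossSet H I v)}
  have hP : MeasurableSet P := measurableSet_setOfPred.2 (Measurable.forall fun v =>
    Measurable.forall fun i => Measurable.forall fun _ => measurableSet_setOfPred.1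
      (measurableSet_le (measurable_tickTime v i) measurable_const))
  have ha : ∀ v, Measurable fun p : Outcome n × (Fin n → Tick n) => elapsed s K p.1 v :=
    fun v => (measurable_elapsed s K v).comp measurable_fst
  have hx : ∀ v, Measurable fun p : Outcome n × (Fin n → Tick n) => (p.2 v).1 := fun v => by fun_prop
  have hc : ∀ v, Measurable fun p : Outcome n × (Fin n → Tick n) => (p.2 v).2 H := fun v => by fun_prop
  have hU : MeasurableSet U := measurableSet_setOfPred.2 (Measurable.forall fun v =>
    measurableSet_setOfPred.1 (measurableSet_lt (ha v) (hx v)))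
  have hD : MeasurableSet D := measurableSet_setOfPred.2 (Measurable.forall fun v =>
    (measurableSet_setOfPred.1 (measurableSet_lt (ha v) (hx v))).and
      ((measurableSet_setOfPred.1 (measurableSet_lt (hx v) ((ha v).add_const δ))).imp
        (measurableSet_setOfPred.1 (hc v (Set.toFinite (crossSet H I v)).measurableSet)).not))
  have hG : Measurable (P.indicator g) := hg.indicator hP
  have hmem : ∀ ω, PosWait ω → ω ∈ tickCounts s K →
      truncate s K ω ∈ P ∧ (truncate s K ω, nextTick K ω) ∈ U ∧ g (truncate s K ω) = g ω := by
    intro ω hω h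
    refine ⟨fun v i hi => ?_, fun v => ?_, ?_⟩
    · rw [tickTime_truncate ω hi]; exact (h v).1 i hi
    · have := (elapsed_lt_iff ω v 0).2 (by simpa using (h v).2)
      simpa [elapsed_truncate] using this
    · exact (hgs _ _ hω (hω.truncate hs K) (agreeUpTo_truncate hω hs h)).symm
  have hmem' : ∀ ω, PosWait ω → truncate s K ω ∈ P → (truncate s K ω, nextTick K ω) ∈ U →
      ω ∈ tickCounts s K := by
    intro ω hω h1 h2 v
    refine ⟨fun i hi => ?_, ?_⟩
    · rw [← tickTime_truncate (s := s) ω hi]; exact h1 v i hi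
    · have h3 : elapsed s K (truncate s K ω) v < (nextTick K ω v).1 := h2 v
      rw [elapsed_truncate] at h3
      simpa using (elapsed_lt_iff ω v 0).1 (by simpa using h3)
  -- With the past fixed, the nodes are independent: both slices are boxes, and the single-node
  -- estimate multiplies over the nodes.
  have hslice : ∀ x ∈ P, Measure.pi (fun v => tickLaw v) (Prod.mk x ⁻¹' D) ≤
      ENNReal.ofReal (Real.exp (-((1 - Real.exp (-δ)) * crossRate H I))) *
        Measure.pi (fun v => tickLaw v) (Prod.mk x ⁻¹' U) := by
    intro x hxP
    have h1 : Prod.mk x ⁻¹' D = Set.univ.pi fun v => {y : Tick n | elapsed s K x v < y.1 ∧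
        (y.1 < elapsed s K x v + δ → y.2 H ∉ crossSet H I v)} := by
      ext y; simp [D]
    have h2 : Prod.mk x ⁻¹' U = Set.univ.pi fun v => {y : Tick n | elapsed s K x v < y.1} := by
      ext y; simp [U]
    rw [h1, h2, Measure.pi_pi, Measure.pi_pi]
    refine le_trans ?_ (mul_le_mul_left (prod_ofReal_one_sub_le H I _) _)
    rw [← Finset.prod_mul_distrib]
    exact Finset.prod_le_prod' fun v _ => tickLaw_noCross H I v (elapsed_nonneg hs (hxP v)) hδ
  calc ∫⁻ ω in tickCounts s K ∩ noCross H I s (s + δ), g ω ∂law n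
      = ∫⁻ ω, (tickCounts s K ∩ noCross H I s (s + δ)).indicator g ω ∂law n :=
        (lintegral_indicator ((measurableSet_tickCounts s K).inter
          (measurableSet_noCross H I s _)) _).symm
    _ ≤ ∫⁻ ω, P.indicator g (truncate s K ω) *
          D.indicator 1 (truncate s K ω, nextTick K ω) ∂law n := by
        refine lintegral_mono_ae ?_
        filter_upwards [ae_posWait] with ω hω
        by_cases h : ω ∈ tickCounts s K ∩ noCross H I s (s + δ)
        swap
        · simp [Set.indicator_of_notMem h]
        obtain ⟨h1, h2, h3⟩ := hmem ω hω h.1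
        have h4 : (truncate s K ω, nextTick K ω) ∈ D := by
          intro v
          refine ⟨h2 v, fun h5 => ?_⟩
          change (nextTick K ω v).1 < elapsed s K (truncate s K ω) v + δ at h5
          rw [elapsed_truncate] at h5
          exact h.2 v (K v) (h.1 v).2 ((lt_elapsed_iff ω v δ).1 h5)
        rw [Set.indicator_of_mem h, Set.indicator_of_mem h1, Set.indicator_of_mem h4, h3]
        simp
    _ = _ := lintegral_truncate_nextTick s K hG hD
    _ ≤ ∫⁻ x, ENNReal.ofReal (Real.exp (-((1 - Real.exp (-δ)) * crossRate H I))) *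
          (P.indicator g x * Measure.pi (fun v => tickLaw v) (Prod.mk x ⁻¹' U))
          ∂((law n).map (truncate s K)) := by
        refine lintegral_mono fun x => ?_
        by_cases hxP : x ∈ P
        · rw [mul_left_comm]
          exact mul_le_mul_right (hslice x hxP) _
        · simp [Set.indicator_of_notMem hxP]
    _ = ENNReal.ofReal (Real.exp (-((1 - Real.exp (-δ)) * crossRate H I))) *
          ∫⁻ ω, P.indicator g (truncate s K ω) *
            U.indicator 1 (truncate s K ω, nextTick K ω) ∂law n := by
        rw [lintegral_const_mul' _ _ ENNReal.ofReal_ne_top, lintegral_truncate_nextTick s K hG hU]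
    _ ≤ _ := by
        refine mul_le_mul_right ?_ _
        rw [← lintegral_indicator (measurableSet_tickCounts s K)]
        refine lintegral_mono_ae ?_
        filter_upwards [ae_posWait] with ω hω
        by_cases h1 : truncate s K ω ∈ P
        · by_cases h2 : (truncate s K ω, nextTick K ω) ∈ U
          · have h := hmem' ω hω h1 h2
            rw [Set.indicator_of_mem h1, Set.indicator_of_mem h2, Set.indicator_of_mem h,
              (hmem ω hω h).2.2]
            simp
          · simp [Set.indicator_of_notMem h2]
        · simp [Set.indicator_of_notMem h1]

/-- The Markov property at time `s`: given what has happened up to time `s`, the probability that no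
call crosses the cut `(I, Iᶜ)` during `(s, s + δ)` is at most `exp (-(1 - exp (-δ)) λ)`, where
`λ` is the rate of the crossing calls. -/
theorem setLIntegral_noCross_le {s δ : ℝ} (hs : 0 ≤ s) (hδ : 0 ≤ δ)
    (H : SimpleGraph (Fin n)) (I : Finset (Fin n)) {g : Outcome n → ℝ≥0∞} (hg : Measurable g)
    (hgs : KnownAt s g) :
    ∫⁻ ω in noCross H I s (s + δ), g ω ∂law n ≤
      ENNReal.ofReal (Real.exp (-((1 - Real.exp (-δ)) * crossRate H I))) *
        ∫⁻ ω, g ω ∂law n := by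
  have hdisj : Pairwise (Function.onFun Disjoint (tickCounts (n := n) s)) := by
    intro K K' hK
    refine Set.disjoint_left.2 fun ω h h' => hK (funext fun v => ?_)
    rcases lt_trichotomy (K v) (K' v) with hlt | heq | hlt
    · exact absurd (h v).2 (not_lt.2 ((h' v).1 _ hlt))
    · exact heq
    · exact absurd (h' v).2 (not_lt.2 ((h v).1 _ hlt))
  have hcover : ∀ᵐ ω ∂law n, ω ∈ ⋃ K, tickCounts s K := by
    filter_upwards [ae_exists_lt_tickTime hs] with ω hω
    classical
    refine Set.mem_iUnion.2 ⟨fun v => Nat.find (hω v), fun v => ⟨fun i hi => ?_, ?_⟩⟩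
    · exact not_lt.1 (Nat.find_min (hω v) hi)
    · exact Nat.find_spec (hω v)
  have hcover' : ∀ᵐ ω ∂law n, ω ∈ noCross H I s (s + δ) →
      ω ∈ ⋃ K, tickCounts s K ∩ noCross H I s (s + δ) := by
    filter_upwards [hcover] with ω h1 h2
    rw [← Set.iUnion_inter]
    exact ⟨h1, h2⟩
  calc ∫⁻ ω in noCross H I s (s + δ), g ω ∂law n
      ≤ ∫⁻ ω in ⋃ K, tickCounts s K ∩ noCross H I s (s + δ), g ω ∂law n :=
        lintegral_mono_set' hcover'
    _ ≤ ∑' K, ∫⁻ ω in tickCounts s K ∩ noCross H I s (s + δ), g ω ∂law n :=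
        lintegral_iUnion_le _ _
    _ ≤ ∑' K, ENNReal.ofReal (Real.exp (-((1 - Real.exp (-δ)) * crossRate H I))) *
          ∫⁻ ω in tickCounts s K, g ω ∂law n :=
        ENNReal.tsum_le_tsum fun K => setLIntegral_tickCounts_noCross_le hs hδ H I hg hgs K
    _ = ENNReal.ofReal (Real.exp (-((1 - Real.exp (-δ)) * crossRate H I))) *
          ∫⁻ ω in ⋃ K, tickCounts s K, g ω ∂law n := by
        rw [ENNReal.tsum_mul_left, lintegral_iUnion (measurableSet_tickCounts s) hdisj]
    _ ≤ _ := mul_le_mul_right (setLIntegral_le_lintegral _ _) _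

end Memoryless

/-! ### The nodes informed along a grid of times -/

section Grid

variable {n : ℕ}

open Classical in
/-- The nodes which are in `I`, or take part in a call in `H` with a node in `I` during the open
interval `(s, t)`. -/
def nextSet (H : SimpleGraph (Fin n)) (ω : Outcome n) (s t : ℝ) (I : Finset (Fin n)) :
    Finset (Fin n) :=
  {w | w ∈ I ∨ ∃ u ∈ I, ∃ k,
    (s < tickTime ω u k ∧ tickTime ω u k < t ∧ H.Adj u w ∧ (ω (u, k)).2 H = w) ∨
    (s < tickTime ω w k ∧ tickTime ω w k < t ∧ H.Adj w u ∧ (ω (w, k)).2 H = u)}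

/-- The grid of times of mesh `1 / n`. -/
def gridTime (n j : ℕ) : ℝ := (j : ℝ) / n

/-- Nodes which are informed at the time `gridTime n j`: in each cell of the grid only one
generation of calls is taken into account. -/
def gridInformed (𝒢 : DynamicNetwork n) (v₀ : Fin n) (ω : Outcome n) : ℕ → Finset (Fin n)
  | 0 => {v₀}
  | j + 1 => nextSet (𝒢.graph (j / n) ω) ω (gridTime n j) (gridTime n (j + 1))
      (gridInformed 𝒢 v₀ ω j)

lemma gridTime_nonneg (n j : ℕ) : 0 ≤ gridTime n j := by unfold gridTime; positivity

lemma gridTime_succ (n j : ℕ) : gridTime n (j + 1) = gridTime n j + 1 / n := by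
  unfold gridTime
  rw [Nat.cast_add, Nat.cast_one, add_div]

lemma gridTime_mono (n : ℕ) : Monotone (gridTime n) := fun i j h => by
  unfold gridTime
  gcongr

lemma mem_nextSet {H : SimpleGraph (Fin n)} {ω : Outcome n} {s t : ℝ} {I : Finset (Fin n)}
    {w : Fin n} : w ∈ nextSet H ω s t I ↔ w ∈ I ∨ ∃ u ∈ I, ∃ k,
    (s < tickTime ω u k ∧ tickTime ω u k < t ∧ H.Adj u w ∧ (ω (u, k)).2 H = w) ∨
    (s < tickTime ω w k ∧ tickTime ω w k < t ∧ H.Adj w u ∧ (ω (w, k)).2 H = u) := by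
  classical
  simp [nextSet]

lemma subset_nextSet (H : SimpleGraph (Fin n)) (ω : Outcome n) (s t : ℝ) (I : Finset (Fin n)) :
    I ⊆ nextSet H ω s t I := fun _ h => mem_nextSet.2 (Or.inl h)

lemma gridInformed_mono (𝒢 : DynamicNetwork n) (v₀ : Fin n) (ω : Outcome n) :
    Monotone (gridInformed 𝒢 v₀ ω) :=
  monotone_nat_of_le_succ fun _ => subset_nextSet _ ω _ _ _

lemma gridInformed_nonempty (𝒢 : DynamicNetwork n) (v₀ : Fin n) (ω : Outcome n) (j : ℕ) :
    (gridInformed 𝒢 v₀ ω j).Nonempty :=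
  ⟨v₀, gridInformed_mono 𝒢 v₀ ω (Nat.zero_le j) (Finset.mem_singleton_self v₀)⟩

lemma card_lt_card_nextSet {H : SimpleGraph (Fin n)} {ω : Outcome n} {s t : ℝ}
    {I : Finset (Fin n)} (h : ω ∉ noCross H I s t) : I.card < (nextSet H ω s t I).card := by
  refine Finset.card_lt_card ⟨subset_nextSet H ω s t I, fun hsub => h ?_⟩
  intro v k h1 h2 h3
  obtain ⟨h3, h4⟩ : H.Adj v ((ω (v, k)).2 H) ∧ ¬(v ∈ I ↔ (ω (v, k)).2 H ∈ I) := h3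
  refine h4 ⟨fun hv => hsub (mem_nextSet.2 (Or.inr ⟨v, hv, k, Or.inl ⟨h1, h2, h3, rfl⟩⟩)),
    fun hw => hsub (mem_nextSet.2 (Or.inr ⟨_, hw, k, Or.inr ⟨h1, h2, h3, rfl⟩⟩))⟩

lemma AgreeUpTo.mono {s t : ℝ} (hst : s ≤ t) {ω ω' : Outcome n} (h : AgreeUpTo t ω ω') :
    AgreeUpTo s ω ω' := fun v k hk => h v k (hk.imp (·.trans hst) (·.trans hst))

lemma AgreeUpTo.symm {t : ℝ} {ω ω' : Outcome n} (h : AgreeUpTo t ω ω') : AgreeUpTo t ω' ω :=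
  fun v k hk => (h v k hk.symm).symm

lemma AgreeUpTo.tickTime_eq {t : ℝ} {ω ω' : Outcome n} (h : AgreeUpTo t ω ω') (hω : PosWait ω)
    {v : Fin n} {k : ℕ} (hk : tickTime ω v k ≤ t) : tickTime ω' v k = tickTime ω v k := by
  refine Finset.sum_congr rfl fun i hi => ?_
  rw [h v i (Or.inl ((hω.tickTime_mono v (by rw [Finset.mem_range] at hi; omega)).trans hk))]

lemma AgreeUpTo.nextSet_subset {s t : ℝ} {ω ω' : Outcome n} (h : AgreeUpTo t ω ω')
    (hω : PosWait ω) (H : SimpleGraph (Fin n)) (I : Finset (Fin n)) :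
    nextSet H ω s t I ⊆ nextSet H ω' s t I := by
  intro w hw
  rw [mem_nextSet] at hw ⊢
  refine hw.imp id ?_
  rintro ⟨u, hu, k, ⟨h1, h2, h3⟩ | ⟨h1, h2, h3⟩⟩
  · refine ⟨u, hu, k, Or.inl ?_⟩
    rw [h.tickTime_eq hω h2.le, ← h u k (Or.inl h2.le)]
    exact ⟨h1, h2, h3⟩
  · refine ⟨u, hu, k, Or.inr ?_⟩
    rw [h.tickTime_eq hω h2.le, ← h w k (Or.inl h2.le)]
    exact ⟨h1, h2, h3⟩

lemma div_le_gridTime (n j : ℕ) : ((j / n : ℕ) : ℝ) ≤ gridTime n j := Nat.cast_div_le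

lemma gridTime_succ_le (hn : 0 < n) (j : ℕ) : gridTime n (j + 1) ≤ ((j / n : ℕ) : ℝ) + 1 := by
  unfold gridTime
  rw [div_le_iff₀ (by exact_mod_cast hn)]
  have := Nat.lt_mul_div_succ j hn
  rw [mul_comm]
  exact_mod_cast this

lemma KnownAt.mono {α : Type*} {s t : ℝ} (hst : s ≤ t) {g : Outcome n → α} (h : KnownAt s g) :
    KnownAt t g := fun ω ω' hω hω' ha => h ω ω' hω hω' (ha.mono hst)

lemma knownAt_graph (𝒢 : DynamicNetwork n) {p : ℕ} {t : ℝ} (hp : (p : ℝ) ≤ t) :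
    KnownAt t (𝒢.graph p) :=
  fun ω ω' _ _ ha => 𝒢.nonanticipating p ω ω' (ha.mono hp)

/-- The graph used in cell `j` has index `j / n` (natural division), so it is exposed no later than
the start of the cell, and the calls used come before its end. -/
lemma knownAt_gridInformed (𝒢 : DynamicNetwork n) (v₀ : Fin n) (j : ℕ) :
    KnownAt (gridTime n j) fun ω => gridInformed 𝒢 v₀ ω j := by
  induction j with
  | zero => intro _ _ _ _ _; rfl
  | succ j ih =>
    intro ω ω' hω hω' ha
    have hj : gridTime n j ≤ gridTime n (j + 1) := gridTime_mono n (Nat.le_succ j)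
    have h1 : gridInformed 𝒢 v₀ ω j = gridInformed 𝒢 v₀ ω' j := ih ω ω' hω hω' (ha.mono hj)
    have h2 := knownAt_graph 𝒢 ((div_le_gridTime n j).trans hj) ω ω' hω hω' ha
    simp only [gridInformed]
    rw [h1, h2]
    exact (ha.nextSet_subset hω _ _).antisymm (ha.symm.nextSet_subset hω' _ _)

lemma measurable_comp_of_countable {Ω α β : Type*} [MeasurableSpace Ω] [MeasurableSpace β]
    [Countable α] {X : Ω → α} (hX : ∀ a, MeasurableSet {ω | X ω = a}) (φ : α → β) :
    Measurable fun ω => φ (X ω) := by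
  let _ : MeasurableSpace α := ⊤
  exact (measurable_from_top (f := φ)).comp (measurable_to_countable' (f := X) hX)

lemma measurableSet_nextSet (H : SimpleGraph (Fin n)) (s t : ℝ) (I I' : Finset (Fin n)) :
    MeasurableSet {ω | nextSet H ω s t I = I'} := by
  have h : {ω | nextSet H ω s t I = I'} = ⋂ w, {ω | w ∈ nextSet H ω s t I ↔ w ∈ I'} := by
    ext ω
    simp [Finset.ext_iff]
  rw [h]
  refine MeasurableSet.iInter fun w => measurableSet_setOfPred.2
    (Measurable.iff ?_ measurable_const)
  simp only [mem_nextSet]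
  have h1 : ∀ v k, Measurable fun ω : Outcome n => s < tickTime ω v k := fun v k =>
    measurableSet_setOfPred.1 (measurableSet_lt measurable_const (measurable_tickTime v k))
  have h2 : ∀ v k, Measurable fun ω : Outcome n => tickTime ω v k < t := fun v k =>
    measurableSet_setOfPred.1 (measurableSet_lt (measurable_tickTime v k) measurable_const)
  have h3 : ∀ v k x, Measurable fun ω : Outcome n => (ω (v, k)).2 H = x := fun v k x =>
    measurableSet_setOfPred.1 (measurableSet_choice H (v, k) {x})
  refine measurable_const.or (Measurable.exists fun u => measurable_const.and
    (Measurable.exists fun k => Measurable.or ?_ ?_))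
  · exact (h1 u k).and ((h2 u k).and (measurable_const.and (h3 u k w)))
  · exact (h1 w k).and ((h2 w k).and (measurable_const.and (h3 w k u)))

lemma measurableSet_gridInformed (𝒢 : DynamicNetwork n) (v₀ : Fin n) (j : ℕ) :
    ∀ I, MeasurableSet {ω | gridInformed 𝒢 v₀ ω j = I} := by
  induction j with
  | zero => intro I; exact MeasurableSet.const ({v₀} = I)
  | succ j ih =>
    intro I'
    have h : {ω | gridInformed 𝒢 v₀ ω (j + 1) = I'} = ⋃ I, ⋃ H,
        {ω | gridInformed 𝒢 v₀ ω j = I} ∩ ({ω | 𝒢.graph (j / n) ω = H} ∩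
          {ω | nextSet H ω (gridTime n j) (gridTime n (j + 1)) I = I'}) := by
      ext ω
      simp [gridInformed]
    rw [h]
    exact MeasurableSet.iUnion fun I => MeasurableSet.iUnion fun H =>
      (ih I).inter ((𝒢.measurableSet_graph _ H).inter (measurableSet_nextSet H _ _ I I'))

lemma informed_of_mem_gridInformed (𝒢 : DynamicNetwork n) (v₀ : Fin n) (ω : Outcome n) (j : ℕ) :
    ∀ w ∈ gridInformed 𝒢 v₀ ω j,
      Informed (fun t => 𝒢.graph t ω) ω v₀ (gridTime n j) w := by
  induction j with
  | zero =>
    intro w hw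
    rw [gridInformed, Finset.mem_singleton] at hw
    subst hw
    simpa [gridTime] using Informed.source
  | succ j ih =>
    have hn : 0 < n := v₀.pos
    have hj : gridTime n j ≤ gridTime n (j + 1) := gridTime_mono n (Nat.le_succ j)
    -- No integer lies inside a cell of mesh `1 / n`, so a single graph is in force throughout it.
    have hfloor : ∀ t, gridTime n j < t → t < gridTime n (j + 1) → ⌊t⌋₊ = j / n := by
      intro t h1 h2
      rw [Nat.floor_eq_iff ((gridTime_nonneg n j).trans h1.le)]
      exact ⟨(div_le_gridTime n j).trans h1.le, h2.trans_le (gridTime_succ_le hn j)⟩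
    intro w hw
    rw [gridInformed, mem_nextSet] at hw
    rcases hw with hw | ⟨u, hu, k, ⟨h1, h2, h3, h4⟩ | ⟨h1, h2, h3, h4⟩⟩
    · exact (ih w hw).keep hj
    · refine ((ih u hu).push h1 ⟨?_, k, rfl, ?_⟩).keep h2.le
      · rw [hfloor _ h1 h2]; exact h3
      · rw [hfloor _ h1 h2]; exact h4
    · refine ((ih u hu).pull h1 ⟨?_, k, rfl, ?_⟩).keep h2.le
      · rw [hfloor _ h1 h2]; exact h3
      · rw [hfloor _ h1 h2]; exact h4

lemma gridInformed_ne_univ (𝒢 : DynamicNetwork n) (v₀ : Fin n) (ω : Outcome n) (t : ℕ)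
    (h : (t : ℝ≥0∞) < spreadTime 𝒢 v₀ ω) : gridInformed 𝒢 v₀ ω (t * n) ≠ Finset.univ := by
  intro hu
  refine absurd h (not_lt.2 ?_)
  have hn : (n : ℝ) ≠ 0 := by exact_mod_cast v₀.pos.ne'
  have ht : gridTime n (t * n) = ((t : ℝ≥0) : ℝ) := by
    unfold gridTime
    push_cast
    field_simp
  refine (iInf₂_le (t : ℝ≥0) fun u => ?_).trans (by simp)
  rw [← ht]
  exact informed_of_mem_gridInformed 𝒢 v₀ ω _ u (hu ▸ Finset.mem_univ u)

end Grid

/-! ### The supermartingale -/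

section Potential

variable {n : ℕ} (𝒢 : DynamicNetwork n) (v₀ : Fin n)
  (e : SimpleGraph (Fin n) → ℝ≥0∞) (f : ℕ → ℝ≥0∞)

/-- The product of the factors `e` of the graphs in force in the first `j` cells of the grid. -/
def gridWeight (j : ℕ) (ω : Outcome n) : ℝ≥0∞ :=
  ∏ i ∈ Finset.range j, e (𝒢.graph (i / n) ω)

/-- The potential: the weight times a function of the number of informed nodes. -/
def potential (j : ℕ) (ω : Outcome n) : ℝ≥0∞ :=
  gridWeight 𝒢 e j ω * f (gridInformed 𝒢 v₀ ω j).card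

lemma measurable_gridWeight (j : ℕ) : Measurable (gridWeight 𝒢 e j) :=
  Finset.measurable_fun_prod _ fun i _ =>
    measurable_comp_of_countable (𝒢.measurableSet_graph (i / n)) e

lemma knownAt_gridWeight (j : ℕ) : KnownAt (gridTime n j) (gridWeight 𝒢 e j) := by
  intro ω ω' hω hω' ha
  refine Finset.prod_congr rfl fun i hi => ?_
  rw [knownAt_graph 𝒢 ((div_le_gridTime n i).trans (gridTime_mono n (Finset.mem_range.1 hi).le))
    ω ω' hω hω' ha]

/-- In a cell of the grid, the factor `e` does not outweigh the decrease of `f` brought about by a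
crossing call. -/
def IsCompensated : Prop := ∀ (H : SimpleGraph (Fin n)) (I : Finset (Fin n)), I.Nonempty →
  I ≠ Finset.univ → e H * (f (I.card + 1) +
    ENNReal.ofReal (Real.exp (-((1 - Real.exp (-(1 / n : ℝ))) * crossRate H I))) *
      (f I.card - f (I.card + 1))) ≤ f I.card

variable {e f}

/-- On an event `B` decided at the start of the cell, with informed set and graph fixed, `f` drops
at least to `f (I.card + 1)` unless no call crosses. The Markov property bounds that exception, and
`IsCompensated` balances it against the new factor `e H`. -/
lemma setLIntegral_potential_succ_le_of_eq (hf : ∀ k m, 1 ≤ k → k ≤ m → f m ≤ f k) (hfn : f n = 0)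
    (hef : IsCompensated e f) (j : ℕ) {B : Set (Outcome n)} (hB : MeasurableSet B)
    (hBk : KnownAt (gridTime n j) (· ∈ B)) {H : SimpleGraph (Fin n)} {I : Finset (Fin n)}
    (hBI : ∀ ω ∈ B, gridInformed 𝒢 v₀ ω j = I) (hBH : ∀ ω ∈ B, 𝒢.graph (j / n) ω = H) :
    ∫⁻ ω in B, potential 𝒢 v₀ e f (j + 1) ω ∂law n ≤ ∫⁻ ω in B, potential 𝒢 v₀ e f j ω ∂law n := by
  rcases B.eq_empty_or_nonempty with rfl | ⟨ω₀, hω₀⟩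
  · simp
  have hI : I.Nonempty := hBI ω₀ hω₀ ▸ gridInformed_nonempty 𝒢 v₀ ω₀ j
  -- Once all nodes are informed there is no cut to cross, but the potential vanishes because `f n =
  -- 0`.
  by_cases hIu : I = Finset.univ
  · have h0 : ∫⁻ ω in B, potential 𝒢 v₀ e f (j + 1) ω ∂law n = 0 := by
      rw [setLIntegral_congr_fun (g := fun _ => 0) hB, lintegral_zero]
      intro ω hω
      have h1 : gridInformed 𝒢 v₀ ω (j + 1) = Finset.univ :=
        Finset.univ_subset_iff.1 (hIu ▸ hBI ω hω ▸ gridInformed_mono 𝒢 v₀ ω (Nat.le_succ j))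
      simp [potential, h1, hfn]
    rw [h0]
    exact zero_le
  set W := gridWeight 𝒢 e j
  set NC := noCross H I (gridTime n j) (gridTime n (j + 1)) with hNC
  set q := ENNReal.ofReal (Real.exp (-((1 - Real.exp (-(1 / n : ℝ))) * crossRate H I)))
  have hW : Measurable W := measurable_gridWeight 𝒢 e j
  have hg : Measurable (B.indicator W) := hW.indicator hB
  have hgk : KnownAt (gridTime n j) (B.indicator W) := by
    intro ω ω' hω hω' ha
    have h1 : ω ∈ B ↔ ω' ∈ B := iff_of_eq (hBk ω ω' hω hω' ha)
    by_cases h : ω ∈ B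
    · rw [Set.indicator_of_mem h, Set.indicator_of_mem (h1.1 h)]
      exact knownAt_gridWeight 𝒢 e j ω ω' hω hω' ha
    · rw [Set.indicator_of_notMem h, Set.indicator_of_notMem fun h2 => h (h1.2 h2)]
  have hNCm : MeasurableSet NC := measurableSet_noCross H I _ _
  have hle : ∀ ω, B.indicator (potential 𝒢 v₀ e f (j + 1)) ω ≤
      e H * (f (I.card + 1) * B.indicator W ω +
        (f I.card - f (I.card + 1)) * NC.indicator (B.indicator W) ω) := by
    intro ω
    by_cases hω : ω ∈ B
    swap
    · simp [Set.indicator_of_notMem hω]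
    have hnext : gridInformed 𝒢 v₀ ω (j + 1) =
        nextSet H ω (gridTime n j) (gridTime n (j + 1)) I := by
      rw [gridInformed, hBI ω hω, hBH ω hω]
    have hpot : potential 𝒢 v₀ e f (j + 1) ω = e H *
        (W ω * f (nextSet H ω (gridTime n j) (gridTime n (j + 1)) I).card) := by
      simp only [potential, gridWeight, Finset.prod_range_succ, hnext, hBH ω hω, W]
      ring
    rw [Set.indicator_of_mem hω, Set.indicator_of_mem hω, hpot]
    gcongr
    by_cases h : ω ∈ NC
    · rw [Set.indicator_of_mem h, Set.indicator_of_mem hω, ← add_mul, mul_comm]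
      gcongr
      exact (hf _ _ hI.card_pos (Finset.card_le_card (subset_nextSet H ω _ _ I))).trans
        le_add_tsub
    · rw [Set.indicator_of_notMem h, mul_zero, add_zero, mul_comm]
      gcongr
      exact hf _ _ (by omega) (card_lt_card_nextSet h)
  have hmarkov : ∫⁻ ω, NC.indicator (B.indicator W) ω ∂law n ≤
      q * ∫⁻ ω, B.indicator W ω ∂law n := by
    rw [lintegral_indicator hNCm, hNC, gridTime_succ]
    exact setLIntegral_noCross_le (gridTime_nonneg n j) (by positivity) H I hg hgk
  calc ∫⁻ ω in B, potential 𝒢 v₀ e f (j + 1) ω ∂law n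
      = ∫⁻ ω, B.indicator (potential 𝒢 v₀ e f (j + 1)) ω ∂law n := (lintegral_indicator hB _).symm
    _ ≤ ∫⁻ ω, e H * (f (I.card + 1) * B.indicator W ω +
        (f I.card - f (I.card + 1)) * NC.indicator (B.indicator W) ω) ∂law n := lintegral_mono hle
    _ = e H * (f (I.card + 1) * ∫⁻ ω, B.indicator W ω ∂law n +
        (f I.card - f (I.card + 1)) * ∫⁻ ω, NC.indicator (B.indicator W) ω ∂law n) := by
        have hm : Measurable fun ω => f (I.card + 1) * B.indicator W ω +
            (f I.card - f (I.card + 1)) * NC.indicator (B.indicator W) ω :=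
          (hg.const_mul _).add ((hg.indicator hNCm).const_mul _)
        rw [lintegral_const_mul _ hm,
          lintegral_add_left (hg.const_mul _), lintegral_const_mul _ hg,
          lintegral_const_mul _ (hg.indicator hNCm)]
    _ ≤ e H * (f (I.card + 1) * ∫⁻ ω, B.indicator W ω ∂law n +
        (f I.card - f (I.card + 1)) * (q * ∫⁻ ω, B.indicator W ω ∂law n)) := by gcongr
    _ = e H * (f (I.card + 1) + q * (f I.card - f (I.card + 1))) *
        ∫⁻ ω, B.indicator W ω ∂law n := by ring
    _ ≤ f I.card * ∫⁻ ω, B.indicator W ω ∂law n := mul_le_mul_left (hef H I hI hIu) _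
    _ = ∫⁻ ω in B, potential 𝒢 v₀ e f j ω ∂law n := by
        rw [lintegral_indicator hB, ← lintegral_const_mul _ hW]
        refine setLIntegral_congr_fun hB fun ω hω => ?_
        simp only [potential, hBI ω hω, W]
        ring

/-- Split `A` according to the finitely many values of the informed set and of the graph in force;
both are known at the start of the cell. -/
lemma setLIntegral_potential_succ_le (hf : ∀ k m, 1 ≤ k → k ≤ m → f m ≤ f k) (hfn : f n = 0)
    (hef : IsCompensated e f) (j : ℕ) {A : Set (Outcome n)} (hA : MeasurableSet A)
    (hAk : KnownAt (gridTime n j) (· ∈ A)) :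
    ∫⁻ ω in A, potential 𝒢 v₀ e f (j + 1) ω ∂law n ≤ ∫⁻ ω in A, potential 𝒢 v₀ e f j ω ∂law n := by
  let B : Finset (Fin n) × SimpleGraph (Fin n) → Set (Outcome n) := fun p =>
    A ∩ ({ω | gridInformed 𝒢 v₀ ω j = p.1} ∩ {ω | 𝒢.graph (j / n) ω = p.2})
  have hB : ∀ p, MeasurableSet (B p) := fun p => hA.inter
    ((measurableSet_gridInformed 𝒢 v₀ j p.1).inter (𝒢.measurableSet_graph _ p.2))
  have hdisj : Pairwise (Function.onFun Disjoint B) := by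
    intro p p' hp
    refine Set.disjoint_left.2 fun ω h h' => hp ?_
    exact Prod.ext (h.2.1.symm.trans h'.2.1) (h.2.2.symm.trans h'.2.2)
  have hcover : A = ⋃ p, B p := by
    ext ω
    refine ⟨fun h => Set.mem_iUnion.2 ⟨(_, _), h, rfl, rfl⟩, fun h => ?_⟩
    obtain ⟨p, hp⟩ := Set.mem_iUnion.1 h
    exact hp.1
  rw [hcover, lintegral_iUnion hB hdisj, lintegral_iUnion hB hdisj]
  refine ENNReal.tsum_le_tsum fun p => setLIntegral_potential_succ_le_of_eq 𝒢 v₀ hf hfn hef j (hB p)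
    ?_ (fun ω hω => hω.2.1) (fun ω hω => hω.2.2)
  intro ω ω' hω hω' ha
  have h1 : (ω ∈ A) = (ω' ∈ A) := hAk ω ω' hω hω' ha
  have h2 : gridInformed 𝒢 v₀ ω j = gridInformed 𝒢 v₀ ω' j :=
    knownAt_gridInformed 𝒢 v₀ j ω ω' hω hω' ha
  have h3 := knownAt_graph 𝒢 (div_le_gridTime n j) ω ω' hω hω' ha
  change (ω ∈ A ∧ gridInformed 𝒢 v₀ ω j = p.1 ∧ 𝒢.graph (j / n) ω = p.2) =
    (ω' ∈ A ∧ gridInformed 𝒢 v₀ ω' j = p.1 ∧ 𝒢.graph (j / n) ω' = p.2)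
  rw [h1, h2, h3]

lemma setLIntegral_potential_add_le (hf : ∀ k m, 1 ≤ k → k ≤ m → f m ≤ f k) (hfn : f n = 0)
    (hef : IsCompensated e f) (j m : ℕ) {A : Set (Outcome n)} (hA : MeasurableSet A)
    (hAk : KnownAt (gridTime n j) (· ∈ A)) :
    ∫⁻ ω in A, potential 𝒢 v₀ e f (j + m) ω ∂law n ≤ ∫⁻ ω in A, potential 𝒢 v₀ e f j ω ∂law n := by
  induction m with
  | zero => exact le_rfl
  | succ m ih => exact (setLIntegral_potential_succ_le 𝒢 v₀ hf hfn hef (j + m) hA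
      (hAk.mono (gridTime_mono n (by omega)))).trans ih

/-- The event that some node is not yet informed at a time `t < N` when the sum of the weights `r`
of the graphs exposed up to time `t` has reached `L`. -/
def lateEvent (r : SimpleGraph (Fin n) → ℝ) (L : ℝ) (N : ℕ) : Set (Outcome n) :=
  {ω | ∃ t < N, L ≤ ∑ p ∈ Finset.range (t + 1), r (𝒢.graph p ω) ∧
    gridInformed 𝒢 v₀ ω (t * n) ≠ Finset.univ}

lemma measurable_sum_weight (r : SimpleGraph (Fin n) → ℝ) (t : ℕ) :
    Measurable fun ω => ∑ p ∈ Finset.range t, r (𝒢.graph p ω) :=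
  Finset.measurable_fun_sum _ fun p _ => measurable_comp_of_countable (𝒢.measurableSet_graph p) r

/-- Optional stopping by induction on `N`. The integral keeps the mass on which the sum has not
reached `L`. When the sum first reaches `L`, the outcomes with an uninformed node leave this mass,
and each carries potential at least `a * f (n - 1)`. -/
lemma mul_law_lateEvent_add_le (hf : ∀ k m, 1 ≤ k → k ≤ m → f m ≤ f k) (hfn : f n = 0)
    (hef : IsCompensated e f) {r : SimpleGraph (Fin n) → ℝ} (hr : ∀ H, 0 ≤ r H) {L : ℝ} (hL : 0 < L)
    {a : ℝ≥0∞} (ha : ∀ t ω, L ≤ ∑ p ∈ Finset.range (t + 1), r (𝒢.graph p ω) →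
      a ≤ gridWeight 𝒢 e (t * n) ω) (N : ℕ) :
    a * f (n - 1) * law n (lateEvent 𝒢 v₀ r L N) +
      ∫⁻ ω in {ω | ∑ p ∈ Finset.range N, r (𝒢.graph p ω) < L},
        potential 𝒢 v₀ e f (N * n) ω ∂law n ≤ f 1 := by
  have hA : ∀ t, MeasurableSet {ω | ∑ p ∈ Finset.range t, r (𝒢.graph p ω) < L} := fun t =>
    measurableSet_lt (measurable_sum_weight 𝒢 r t) measurable_const
  induction N with
  | zero =>
    have h : lateEvent 𝒢 v₀ r L 0 = ∅ := by
      refine Set.eq_empty_iff_forall_notMem.2 ?_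
      rintro ω ⟨t, ht, -⟩
      exact absurd ht (Nat.not_lt_zero t)
    rw [h, measure_empty, mul_zero, zero_add]
    refine (setLIntegral_le_lintegral _ _).trans ?_
    simp [potential, gridWeight, gridInformed]
  | succ N ih =>
    set A := {ω | ∑ p ∈ Finset.range N, r (𝒢.graph p ω) < L}
    set A' := {ω | ∑ p ∈ Finset.range (N + 1), r (𝒢.graph p ω) < L}
    set E := A ∩ (A'ᶜ ∩ {ω | gridInformed 𝒢 v₀ ω (N * n) = Finset.univ}ᶜ)
    have hE : MeasurableSet E := (hA N).inter ((hA (N + 1)).compl.inter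
      (measurableSet_gridInformed 𝒢 v₀ _ _).compl)
    have hlate : lateEvent 𝒢 v₀ r L (N + 1) ⊆ lateEvent 𝒢 v₀ r L N ∪ E := by
      rintro ω ⟨t, ht, h1, h2⟩
      rcases Nat.lt_succ_iff_lt_or_eq.1 ht with h | rfl
      · exact Or.inl ⟨t, h, h1, h2⟩
      · by_cases h3 : ω ∈ A
        · exact Or.inr ⟨h3, not_lt.2 h1, h2⟩
        · left
          have h3 : L ≤ ∑ p ∈ Finset.range t, r (𝒢.graph p ω) := not_lt.1 h3
          -- If the sum had reached `L` earlier, the outcome was already late then, as informed sets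
          -- only grow. For `t = 0` the empty sum contradicts `0 < L`.
          obtain _ | t := t
          · simp at h3; linarith
          · refine ⟨t, Nat.lt_succ_self t, h3, fun h4 => h2 ?_⟩
            exact Finset.univ_subset_iff.1 (h4 ▸ gridInformed_mono 𝒢 v₀ ω
              (Nat.mul_le_mul_right n (Nat.le_succ t)))
    have hsub : A' ⊆ A := by
      intro ω (hω : ∑ p ∈ Finset.range (N + 1), r (𝒢.graph p ω) < L)
      rw [Finset.sum_range_succ] at hω
      exact lt_of_le_of_lt (le_add_of_nonneg_right (hr _)) hω
    -- `A'` involves the graph with index `N`, which is exposed exactly at time `N`, so `A'` is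
    -- decided before the next `n` cells.
    have hAk : KnownAt (gridTime n (N * n)) (· ∈ A') := by
      intro ω ω' hω hω' hag
      have hn : (n : ℝ) ≠ 0 := by exact_mod_cast v₀.pos.ne'
      have hN : gridTime n (N * n) = N := by
        unfold gridTime; push_cast; field_simp
      have h : ∑ p ∈ Finset.range (N + 1), r (𝒢.graph p ω) =
          ∑ p ∈ Finset.range (N + 1), r (𝒢.graph p ω') := by
        refine Finset.sum_congr rfl fun p hp => ?_
        rw [knownAt_graph 𝒢 (p := p) (t := gridTime n (N * n)) ?_ ω ω' hω hω' hag]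
        rw [hN]
        exact_mod_cast Nat.lt_succ_iff.1 (Finset.mem_range.1 hp)
      change (_ < L) = (_ < L)
      rw [h]
    have hEle : a * f (n - 1) * law n E ≤ ∫⁻ ω in E, potential 𝒢 v₀ e f (N * n) ω ∂law n := by
      rw [← setLIntegral_const]
      refine setLIntegral_mono' hE fun ω hω => ?_
      have h1 : L ≤ ∑ p ∈ Finset.range (N + 1), r (𝒢.graph p ω) := not_lt.1 hω.2.1
      have h2 : (gridInformed 𝒢 v₀ ω (N * n)).card < n := by
        have := (Finset.card_lt_iff_ne_univ (gridInformed 𝒢 v₀ ω (N * n))).2 hω.2.2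
        simpa using this
      exact mul_le_mul' (ha N ω h1) (hf _ _ (gridInformed_nonempty 𝒢 v₀ ω _).card_pos (by omega))
    have hdisj : Disjoint E A' := Set.disjoint_left.2 fun ω h h' => h.2.1 h'
    calc a * f (n - 1) * law n (lateEvent 𝒢 v₀ r L (N + 1)) +
          ∫⁻ ω in A', potential 𝒢 v₀ e f ((N + 1) * n) ω ∂law n
        ≤ a * f (n - 1) * (law n (lateEvent 𝒢 v₀ r L N) + law n E) +
          ∫⁻ ω in A', potential 𝒢 v₀ e f (N * n) ω ∂law n := by
          refine add_le_add (mul_le_mul_right ((measure_mono hlate).trans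
            (measure_union_le _ _)) _) ?_
          · rw [Nat.succ_mul]
            exact setLIntegral_potential_add_le 𝒢 v₀ hf hfn hef (N * n) n (hA (N + 1)) hAk
      _ ≤ a * f (n - 1) * law n (lateEvent 𝒢 v₀ r L N) +
          (∫⁻ ω in E, potential 𝒢 v₀ e f (N * n) ω ∂law n +
            ∫⁻ ω in A', potential 𝒢 v₀ e f (N * n) ω ∂law n) := by
          rw [mul_add, add_assoc]
          gcongr
      _ ≤ a * f (n - 1) * law n (lateEvent 𝒢 v₀ r L N) +
          ∫⁻ ω in A, potential 𝒢 v₀ e f (N * n) ω ∂law n := by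
          rw [← lintegral_union (hA (N + 1)) hdisj]
          gcongr
          exact Set.union_subset Set.inter_subset_left hsub
      _ ≤ f 1 := ih

theorem mul_law_late_le (hf : ∀ k m, 1 ≤ k → k ≤ m → f m ≤ f k) (hfn : f n = 0)
    (hef : IsCompensated e f) {r : SimpleGraph (Fin n) → ℝ} (hr : ∀ H, 0 ≤ r H) {L : ℝ} (hL : 0 < L)
    {a : ℝ≥0∞} (ha : ∀ t ω, L ≤ ∑ p ∈ Finset.range (t + 1), r (𝒢.graph p ω) →
      a ≤ gridWeight 𝒢 e (t * n) ω) :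
    a * f (n - 1) * law n {ω | ∃ t : ℕ, L ≤ ∑ p ∈ Finset.range (t + 1), r (𝒢.graph p ω) ∧
      (t : ℝ≥0∞) < spreadTime 𝒢 v₀ ω} ≤ f 1 := by
  have hmono : Monotone (lateEvent 𝒢 v₀ r L) := by
    rintro N N' h ω ⟨t, ht, h1⟩
    exact ⟨t, ht.trans_le h, h1⟩
  have hsub : {ω | ∃ t : ℕ, L ≤ ∑ p ∈ Finset.range (t + 1), r (𝒢.graph p ω) ∧
      (t : ℝ≥0∞) < spreadTime 𝒢 v₀ ω} ⊆ ⋃ N, lateEvent 𝒢 v₀ r L N := by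
    rintro ω ⟨t, h1, h2⟩
    exact Set.mem_iUnion.2 ⟨t + 1, t, Nat.lt_succ_self t, h1, gridInformed_ne_univ 𝒢 v₀ ω t h2⟩
  refine (mul_le_mul_right (measure_mono hsub) _).trans ?_
  rw [hmono.measure_iUnion, ENNReal.mul_iSup]
  exact iSup_le fun N => le_self_add.trans
    (mul_law_lateEvent_add_le 𝒢 v₀ hf hfn hef hr hL ha N)

end Potential

/-! ### Tail bounds for the two weights -/

section TailBounds

variable {n : ℕ}

lemma gridWeight_mul (𝒢 : DynamicNetwork n) (hn : 0 < n) (e : SimpleGraph (Fin n) → ℝ≥0∞) (t : ℕ)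
    (ω : Outcome n) :
    gridWeight 𝒢 e (t * n) ω = ∏ p ∈ Finset.range t, e (𝒢.graph p ω) ^ n := by
  induction t with
  | zero => simp [gridWeight]
  | succ t ih =>
    rw [Finset.prod_range_succ, ← ih, Nat.succ_mul]
    unfold gridWeight
    rw [Finset.prod_range_add]
    congr 1
    rw [Finset.prod_congr rfl (g := fun _ => e (𝒢.graph t ω)), Finset.prod_const,
      Finset.card_range]
    intro x hx
    rw [mul_comm, Nat.mul_add_div hn, Nat.div_eq_of_lt (Finset.mem_range.1 hx), add_zero]

/-- If on average each cell of the grid decreases `F` of the number of informed nodes by a factor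
`1 - θ r / n`, then it is unlikely that some node is uninformed when the sum of the weights `r` has
reached `L`. -/
theorem law_late_le (𝒢 : DynamicNetwork n) (v₀ : Fin n) {r : SimpleGraph (Fin n) → ℝ}
    {F : ℕ → ℝ} {θ L M : ℝ} (hr : ∀ H, 0 ≤ r H) (hrM : ∀ H, r H ≤ M) (hθ : 0 ≤ θ) (hL : 0 < L)
    (hF : ∀ k m, 1 ≤ k → k ≤ m → F m ≤ F k) (hFn : F n = 0) (hFpos : 0 < F (n - 1))
    (hstep : ∀ (H : SimpleGraph (Fin n)) (I : Finset (Fin n)), I.Nonempty → I ≠ Finset.univ →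
      θ * r H / n * F I.card ≤ (1 - Real.exp (-((1 - Real.exp (-(1 / n : ℝ))) * crossRate H I))) *
        (F I.card - F (I.card + 1))) :
    law n {ω | ∃ t : ℕ, L ≤ ∑ p ∈ Finset.range (t + 1), r (𝒢.graph p ω) ∧
      (t : ℝ≥0∞) < spreadTime 𝒢 v₀ ω} ≤
        ENNReal.ofReal (F 1 / F (n - 1) * Real.exp (-(θ * (L - M)))) := by
  have hn : 0 < n := v₀.pos
  have hn' : (n : ℝ) ≠ 0 := by exact_mod_cast hn.ne'
  have hFnn : ∀ k, 1 ≤ k → k ≤ n → 0 ≤ F k := fun k h1 h2 => hFn ▸ hF k n h1 h2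
  have hef : IsCompensated (fun H => ENNReal.ofReal (Real.exp (θ * r H / n)))
      fun k => ENNReal.ofReal (F k) := by
    intro H I hI hIu
    have hcard : I.card < n := by simpa using (Finset.card_lt_iff_ne_univ I).2 hIu
    have h1 : 0 ≤ F (I.card + 1) := hFnn _ (by omega) (by omega)
    have h2 : F (I.card + 1) ≤ F I.card := hF _ _ hI.card_pos (Nat.le_succ _)
    have h3 := hstep H I hI hIu
    set q := Real.exp (-((1 - Real.exp (-(1 / n : ℝ))) * crossRate H I))
    have hq : 0 ≤ q := Real.exp_nonneg _
    rw [← ENNReal.ofReal_sub _ h1, ← ENNReal.ofReal_mul hq, ← ENNReal.ofReal_add h1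
      (mul_nonneg hq (by linarith)), ← ENNReal.ofReal_mul (Real.exp_nonneg _)]
    refine ENNReal.ofReal_le_ofReal ?_
    set x := θ * r H / n
    -- The inequality `1 - x ≤ exp (-x)` turns the average decrease into one that the factor `exp x`
    -- cancels exactly.
    have h4 : F (I.card + 1) + q * (F I.card - F (I.card + 1)) ≤ Real.exp (-x) * F I.card := by
      have : (1 - x) * F I.card ≤ Real.exp (-x) * F I.card :=
        mul_le_mul_of_nonneg_right (by linarith [Real.add_one_le_exp (-x)]) (h1.trans h2)
      linarith
    calc _ ≤ Real.exp x * (Real.exp (-x) * F I.card) :=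
          mul_le_mul_of_nonneg_left h4 (Real.exp_nonneg _)
      _ = F I.card := by rw [← mul_assoc, ← Real.exp_add, add_neg_cancel, Real.exp_zero, one_mul]
  -- At time `t` the weight contains only the graphs before index `t`; the missing last term costs
  -- at most `M`.
  have ha : ∀ t ω, L ≤ ∑ p ∈ Finset.range (t + 1), r (𝒢.graph p ω) →
      ENNReal.ofReal (Real.exp (θ * (L - M))) ≤
        gridWeight 𝒢 (fun H => ENNReal.ofReal (Real.exp (θ * r H / n))) (t * n) ω := by
    intro t ω h
    rw [gridWeight_mul 𝒢 hn]
    have h1 : ∀ p, ENNReal.ofReal (Real.exp (θ * r (𝒢.graph p ω) / n)) ^ n =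
        ENNReal.ofReal (Real.exp (θ * r (𝒢.graph p ω))) := by
      intro p
      rw [← ENNReal.ofReal_pow (Real.exp_nonneg _), ← Real.exp_nat_mul, mul_div_cancel₀ _ hn']
    simp only [h1]
    rw [← ENNReal.ofReal_prod_of_nonneg fun _ _ => Real.exp_nonneg _, ← Real.exp_sum,
      ← Finset.mul_sum]
    rw [Finset.sum_range_succ] at h
    refine ENNReal.ofReal_le_ofReal (Real.exp_le_exp.2 (mul_le_mul_of_nonneg_left ?_ hθ))
    linarith [hrM (𝒢.graph t ω)]
  have h := mul_law_late_le 𝒢 v₀ (f := fun k => ENNReal.ofReal (F k))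
    (fun k m h1 h2 => ENNReal.ofReal_le_ofReal (hF k m h1 h2)) (by simp [hFn]) hef hr hL ha
  rw [← ENNReal.ofReal_mul (Real.exp_nonneg _), mul_comm] at h
  have hpos : 0 < Real.exp (θ * (L - M)) * F (n - 1) := mul_pos (Real.exp_pos _) hFpos
  rw [← ENNReal.le_div_iff_mul_le (Or.inl (by simpa using hpos)) (Or.inl ENNReal.ofReal_ne_top),
    ← ENNReal.ofReal_div_of_pos hpos] at h
  refine h.trans (ENNReal.ofReal_le_ofReal (le_of_eq ?_))
  rw [Real.exp_neg]
  field_simp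

lemma div_one_add_le_one_sub_exp_neg {z : ℝ} (hz : 0 ≤ z) : z / (1 + z) ≤ 1 - Real.exp (-z) := by
  have h : Real.exp (-z) ≤ 1 / (1 + z) := by
    rw [Real.exp_neg, ← one_div]
    exact one_div_le_one_div_of_le (by linarith) (by linarith [Real.add_one_le_exp z])
  have h2 : z / (1 + z) = 1 - 1 / (1 + z) := by field_simp; ring
  linarith

lemma one_sub_exp_neg_inv_le (n : ℕ) : 1 - Real.exp (-(1 / n : ℝ)) ≤ 1 / n := by
  linarith [Real.add_one_le_exp (-(1 / n : ℝ))]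

lemma le_one_sub_exp_neg_inv {n : ℕ} (hn : 0 < n) :
    1 / ((n : ℝ) + 1) ≤ 1 - Real.exp (-(1 / n : ℝ)) := by
  have hn' : (0 : ℝ) < n := by exact_mod_cast hn
  have h := div_one_add_le_one_sub_exp_neg (z := 1 / (n : ℝ)) (by positivity)
  have h2 : 1 / (n : ℝ) / (1 + 1 / n) = 1 / ((n : ℝ) + 1) := by field_simp
  rwa [h2] at h

/-- One factor `2` comes from `1/(n+1) ≥ 1/(2n)`. The other comes from `z/(1+z) ≥ z/2`, valid
because the exponent `z` is at most `1` when the rate is at most `n`. -/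
lemma le_prob_cross (hn : 0 < n) (H : SimpleGraph (Fin n)) (I : Finset (Fin n)) :
    crossRate H I / (4 * n) ≤
      1 - Real.exp (-((1 - Real.exp (-(1 / n : ℝ))) * crossRate H I)) := by
  have hn' : (0 : ℝ) < n := by exact_mod_cast hn
  have hn1 : (1 : ℝ) ≤ n := by exact_mod_cast hn
  have h0 := crossRate_nonneg H I
  have h1 := crossRate_le H I
  set d := 1 - Real.exp (-(1 / n : ℝ))
  have hd : 1 / (2 * n) ≤ d :=
    (one_div_le_one_div_of_le (by positivity) (by linarith)).trans (le_one_sub_exp_neg_inv hn)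
  have hd0 : 0 ≤ d := le_trans (by positivity) hd
  have hz1 : d * crossRate H I ≤ 1 :=
    (mul_le_mul (one_sub_exp_neg_inv_le n) h1 h0 (by positivity)).trans
      (by rw [one_div_mul_cancel hn'.ne'])
  have hz0 : 0 ≤ d * crossRate H I := mul_nonneg hd0 h0
  refine le_trans ?_ (div_one_add_le_one_sub_exp_neg hz0)
  calc crossRate H I / (4 * n) = (1 / (2 * n) * crossRate H I) / 2 := by field_simp; norm_num
    _ ≤ d * crossRate H I / 2 := by gcongr
    _ ≤ _ := div_le_div_of_nonneg_left hz0 (by linarith) (by linarith)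

lemma boundConst_ge {c : ℝ} (hc : 0 ≤ c) : 40 * c + 80 ≤ boundConst c := by
  have h1 := Real.exp_one_gt_d9
  have h2 := Real.exp_one_lt_d9
  have h3 : 1 / Real.exp 1 < 1 / 2 := one_div_lt_one_div_of_lt (by norm_num) (by linarith)
  -- From `e < 4` follows `c₀ < 1/4`, so division by `c₀` gains a factor of at least `4`.
  have h4 : 1 / 4 < 1 / Real.exp 1 := one_div_lt_one_div_of_lt (by positivity) (by linarith)
  unfold boundConst
  rw [le_div_iff₀ (by linarith)]
  nlinarith

/-- With `F k = n/k - 1`, the relative drop from `k` to `k + 1` is `n / ((n-k)(k+1))`, and its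
product with `min k (n-k)` is at least `1/2` both for small and for large `k`. Together with the
`1/4` of `le_prob_cross` this gives `θ = 1/8`. The exponent `c + 1` leaves room for a union bound.
-/
lemma law_late_diligence_le {c : ℝ} (hc : 0 ≤ c) (hn : 2 ≤ n) (𝒢 : DynamicNetwork n) (v₀ : Fin n) :
    law n {ω | ∃ t : ℕ, boundConst c * Real.log n ≤ ∑ p ∈ Finset.range (t + 1),
        conductance (𝒢.graph p ω) * diligence (𝒢.graph p ω) ∧ (t : ℝ≥0∞) < spreadTime 𝒢 v₀ ω} ≤
      ENNReal.ofReal ((n : ℝ) ^ (-(c + 1))) := by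
  have hn2 : (2 : ℝ) ≤ n := by exact_mod_cast hn
  have hn0 : (0 : ℝ) < n := by linarith
  have hlog : 1 / 2 ≤ Real.log n := by
    have := Real.log_le_log two_pos hn2
    linarith [Real.log_two_gt_d9]
  have hC := boundConst_ge hc
  have hFeq : ∀ k : ℕ, 1 ≤ k → ((n : ℝ) - k) / k = n / k - 1 := by
    intro k hk
    have : (k : ℝ) ≠ 0 := by exact_mod_cast (by omega : k ≠ 0)
    field_simp
  have hcast : ((n - 1 : ℕ) : ℝ) = n - 1 := by rw [Nat.cast_sub (by omega), Nat.cast_one]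
  refine (law_late_le 𝒢 v₀ (r := fun H => conductance H * diligence H)
    (F := fun k => ((n : ℝ) - k) / k) (θ := 1 / 8) (M := 2) (fun H => conductance_mul_diligence_nonneg H)
    (conductance_mul_diligence_le_two hn) (by norm_num)
    (mul_pos (by linarith) (by linarith)) ?_ ?_ ?_ ?_).trans (ENNReal.ofReal_le_ofReal ?_)
  · intro k m hk hkm
    have h1 : (1 : ℝ) ≤ k := by exact_mod_cast hk
    have h2 : (k : ℝ) ≤ m := by exact_mod_cast hkm
    rw [hFeq k hk, hFeq m (hk.trans hkm)]
    gcongr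
  · simp
  · simp only [hcast]
    exact div_pos (by linarith) (by linarith)
  · intro H I hI hIu
    have hcard : I.card < n := by simpa using (Finset.card_lt_iff_ne_univ I).2 hIu
    have h1 := le_prob_cross (by omega) H I
    have h2 := conductance_mul_diligence_mul_min_le (H := H) hI hIu
    have h3 := conductance_mul_diligence_nonneg H
    have hk1 : (1 : ℝ) ≤ I.card := by exact_mod_cast hI.card_pos
    have hkn : (I.card : ℝ) + 1 ≤ n := by exact_mod_cast hcard
    set r := conductance H * diligence H
    set k : ℝ := (I.card : ℝ)
    have hdiff : ((n : ℝ) - k) / k - ((n : ℝ) - ((I.card + 1 : ℕ) : ℝ)) / ((I.card + 1 : ℕ) : ℝ) =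
        n / (k * (k + 1)) := by
      push_cast
      field_simp
      ring
    rw [hdiff]
    refine le_trans ?_ (mul_le_mul_of_nonneg_right h1 (by positivity))
    have hkey : r * ((n - k) * (k + 1)) ≤ 2 * crossRate H I * n := by
      refine le_trans ?_ (mul_le_mul_of_nonneg_right
        (mul_le_mul_of_nonneg_left h2 zero_le_two) hn0.le)
      have hmin : (n - k) * (k + 1) ≤ 2 * min k (n - k) * n := by
        rcases le_total k (n - k) with h | h
        · rw [min_eq_left h]; nlinarith
        · rw [min_eq_right h]; nlinarith
      calc r * ((n - k) * (k + 1)) ≤ r * (2 * min k (n - k) * n) :=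
            mul_le_mul_of_nonneg_left hmin h3
        _ = _ := by ring
    have e1 : 1 / 8 * r / n * ((n - k) / k) = r * ((n - k) * (k + 1)) / (8 * n * k * (k + 1)) := by
      field_simp
    have e2 : crossRate H I / (4 * n) * (n / (k * (k + 1))) =
        2 * crossRate H I * n / (8 * n * k * (k + 1)) := by
      field_simp; ring
    rw [e1, e2]
    gcongr
  · simp only [hcast, Nat.cast_one, div_one]
    have h1 : ((n : ℝ) - 1) / ((n - (n - 1)) / (n - 1)) = (n - 1) ^ 2 := by
      rw [sub_sub_cancel]
      field_simp
    have h2 : ((n : ℝ) - 1) ^ 2 ≤ Real.exp (2 * Real.log n) := by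
      rw [two_mul, Real.exp_add, Real.exp_log hn0]
      nlinarith
    rw [h1, Real.rpow_def_of_pos hn0]
    refine (mul_le_mul_of_nonneg_right h2 (Real.exp_nonneg _)).trans ?_
    rw [← Real.exp_add, Real.exp_le_exp]
    have h3 : (40 * c + 80) * Real.log n ≤ boundConst c * Real.log n :=
      mul_le_mul_of_nonneg_right hC (by linarith)
    have h4 : 0 ≤ c * Real.log n := mul_nonneg hc (by linarith)
    -- The exponent is at most `2 log n + 1/4 - (5c + 10) log n`; the constant `1/4`, which is `θ
    -- M`, is absorbed by `log n ≥ 1/2`.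
    linarith

/-- The rate bound does not depend on `|I|`, so a geometric `F` fits: each new node at least halves
it. A crossing probability of at least `0.9 r / n` gives `θ = 0.45`, and `0.45 (2n - 1)` exceeds `n
log 2` by a linear margin. -/
lemma law_late_absDiligence_le (hn : 20 ≤ n) (𝒢 : DynamicNetwork n) (v₀ : Fin n) :
    law n {ω | ∃ t : ℕ, 2 * (n : ℝ) ≤ ∑ p ∈ Finset.range (t + 1),
        ceilConductance (𝒢.graph p ω) * absDiligence (𝒢.graph p ω) ∧
          (t : ℝ≥0∞) < spreadTime 𝒢 v₀ ω} ≤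
      ENNReal.ofReal (Real.exp (1 - n / 5)) := by
  have hn2 : (20 : ℝ) ≤ n := by exact_mod_cast hn
  have hn0 : (0 : ℝ) < n := by linarith
  have hF : ∀ k < n, (if k < n then (1 / 2 : ℝ) ^ k else 0) = (1 / 2 : ℝ) ^ k :=
    fun k hk => if_pos hk
  refine (law_late_le 𝒢 v₀ (r := fun H => ceilConductance H * absDiligence H)
    (F := fun k => if k < n then (1 / 2 : ℝ) ^ k else 0) (θ := 0.45) (M := 1)
    (fun H => ceilConductance_mul_absDiligence_nonneg H)
    ceilConductance_mul_absDiligence_le_one (by norm_num)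
    (by linarith) ?_ ?_ ?_ ?_).trans (ENNReal.ofReal_le_ofReal ?_)
  · intro k m hk hkm
    by_cases hm : m < n
    · simp only [hF m hm, hF k (by omega)]
      exact pow_le_pow_of_le_one (by norm_num) (by norm_num) hkm
    · simp only [if_neg hm]
      split_ifs <;> positivity
  · simp
  · simp only [hF (n - 1) (by omega)]
    positivity
  · intro H I hI hIu
    have hcard : I.card < n := by simpa using (Finset.card_lt_iff_ne_univ I).2 hIu
    have h0 := ceilConductance_mul_absDiligence_nonneg H
    have h1 := ceilConductance_mul_absDiligence_le_one H
    have h2 := ceilConductance_mul_absDiligence_le (H := H) hI hIu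
    set r := ceilConductance H * absDiligence H
    set d := 1 - Real.exp (-(1 / n : ℝ))
    have hd : 1 / ((n : ℝ) + 1) ≤ d := le_one_sub_exp_neg_inv (by omega)
    have hd1 : d ≤ 1 / n := one_sub_exp_neg_inv_le n
    have hd0 : 0 ≤ d := le_trans (by positivity) hd
    have hy : 0.9 * r / n ≤ 1 - Real.exp (-(d * crossRate H I)) := by
      have h3 : Real.exp (-(d * crossRate H I)) ≤ Real.exp (-(d * r)) :=
        Real.exp_le_exp.2 (neg_le_neg (mul_le_mul_of_nonneg_left h2 hd0))
      have hz0 : 0 ≤ d * r := mul_nonneg hd0 h0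
      have h4 := div_one_add_le_one_sub_exp_neg hz0
      have h5 : d * r ≤ 1 / n := (mul_le_of_le_one_right hd0 h1).trans hd1
      calc 0.9 * r / n ≤ (1 / ((n : ℝ) + 1) * r) / (1 + 1 / n) := by
            have e : (1 / ((n : ℝ) + 1) * r) / (1 + 1 / n) = r * (n / (n + 1) ^ 2) := by
              field_simp
            have e' : 0.9 * r / n = r * (0.9 / n) := by ring
            rw [e, e']
            refine mul_le_mul_of_nonneg_left ?_ h0
            -- What remains is `0.9 (n+1)² ≤ n²`, which holds for `n ≥ 20`.
            rw [div_le_div_iff₀ hn0 (by positivity)]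
            nlinarith
        _ ≤ d * r / (1 + 1 / n) := by gcongr
        _ ≤ d * r / (1 + d * r) := div_le_div_of_nonneg_left hz0 (by linarith) (by linarith)
        _ ≤ _ := by linarith
    have hdiff : (1 / 2 : ℝ) ^ I.card / 2 ≤ (1 / 2 : ℝ) ^ I.card -
        (if I.card + 1 < n then (1 / 2 : ℝ) ^ (I.card + 1) else 0) := by
      have : (0 : ℝ) < (1 / 2) ^ I.card := by positivity
      split_ifs
      · rw [pow_succ]; linarith
      · linarith
    simp only [hF _ hcard]
    calc 0.45 * r / n * (1 / 2 : ℝ) ^ I.card = 0.9 * r / n * ((1 / 2 : ℝ) ^ I.card / 2) := by ring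
      _ ≤ _ := mul_le_mul hy hdiff (by positivity) (le_trans (by positivity) hy)
  · simp only [hF 1 (by omega), hF (n - 1) (by omega)]
    have h1 : (1 / 2 : ℝ) ^ 1 / (1 / 2) ^ (n - 1) ≤ Real.exp (0.7 * n) := by
      have h2 : (2 : ℝ) ≤ Real.exp 0.7 := by
        rw [← Real.log_le_iff_le_exp two_pos]
        linarith [Real.log_two_lt_d9]
      calc (1 / 2 : ℝ) ^ 1 / (1 / 2) ^ (n - 1) = 1 / 2 * 2 ^ (n - 1) := by
            rw [one_div_pow, pow_one, div_eq_mul_inv, one_div, inv_pow, inv_inv]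
        _ ≤ 2 ^ n := by
            have : (2 : ℝ) ^ (n - 1) ≤ 2 ^ n := pow_le_pow_right₀ one_le_two (by omega)
            linarith [show (0 : ℝ) < 2 ^ (n - 1) by positivity]
        _ ≤ Real.exp 0.7 ^ n := pow_le_pow_left₀ zero_le_two h2 n
        _ = _ := by rw [← Real.exp_nat_mul, mul_comm]
    refine (mul_le_mul_of_nonneg_right h1 (Real.exp_nonneg _)).trans ?_
    rw [← Real.exp_add, Real.exp_le_exp]
    linarith

lemma eventually_exp_le_rpow {c : ℝ} (hc : 0 ≤ c) :
    ∀ᶠ n : ℕ in Filter.atTop, Real.exp (1 - n / 5) ≤ (n : ℝ) ^ (-(c + 1)) := by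
  have h := (Real.isLittleO_log_id_atTop.comp_tendsto tendsto_natCast_atTop_atTop).bound
    (c := 1 / (10 * (c + 1))) (by positivity)
  filter_upwards [h, Filter.eventually_ge_atTop 10] with n h1 h2
  have hn : (10 : ℝ) ≤ n := by exact_mod_cast h2
  have h3 : Real.log n ≤ 1 / (10 * (c + 1)) * n := by
    have := (le_abs_self _).trans h1
    simpa using this
  rw [Real.rpow_def_of_pos (by linarith), Real.exp_le_exp]
  have h4 : Real.log n * (c + 1) ≤ n / 10 := by
    calc Real.log n * (c + 1) ≤ 1 / (10 * (c + 1)) * n * (c + 1) := by gcongr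
      _ = n / 10 := by field_simp
  linarith

end TailBounds

/-! ### From the infima to a witnessing time, and the union bound -/

lemma diligenceBound_lt_subset {n : ℕ} (𝒢 : DynamicNetwork n) (v₀ : Fin n) (c : ℝ) :
    {ω | diligenceBound 𝒢 c ω < spreadTime 𝒢 v₀ ω} ⊆
      {ω | ∃ t : ℕ, boundConst c * Real.log n ≤ ∑ p ∈ Finset.range (t + 1),
        conductance (𝒢.graph p ω) * diligence (𝒢.graph p ω) ∧
          (t : ℝ≥0∞) < spreadTime 𝒢 v₀ ω} := by
  intro ω (h : diligenceBound 𝒢 c ω < spreadTime 𝒢 v₀ ω)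
  unfold diligenceBound at h
  simp only [iInf_lt_iff] at h
  obtain ⟨t, h1, h2⟩ := h
  exact ⟨t, h1, h2⟩

lemma absDiligenceBound_lt_subset {n : ℕ} (𝒢 : DynamicNetwork n) (v₀ : Fin n) :
    {ω | absDiligenceBound 𝒢 ω < spreadTime 𝒢 v₀ ω} ⊆
      {ω | ∃ t : ℕ, 2 * (n : ℝ) ≤ ∑ p ∈ Finset.range (t + 1),
        ceilConductance (𝒢.graph p ω) * absDiligence (𝒢.graph p ω) ∧
          (t : ℝ≥0∞) < spreadTime 𝒢 v₀ ω} := by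
  intro ω (h : absDiligenceBound 𝒢 ω < spreadTime 𝒢 v₀ ω)
  unfold absDiligenceBound at h
  simp only [iInf_lt_iff] at h
  obtain ⟨t, h1, h2⟩ := h
  exact ⟨t, h1, h2⟩

end RumorSpreading

end

theorem mainTheorem6 (c : ℝ) (hc : 1 < c) :
    (∀ (n : ℕ) (𝒢 : RumorSpreading.DynamicNetwork n) (v₀ : Fin n),
      RumorSpreading.law n {ω | RumorSpreading.diligenceBound 𝒢 c ω <
          RumorSpreading.spreadTime 𝒢 v₀ ω} ≤ ENNReal.ofReal ((n : ℝ) ^ (-c))) ∧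
    ∃ n₀ : ℕ, ∀ n : ℕ, n₀ ≤ n → ∀ (𝒢 : RumorSpreading.DynamicNetwork n) (v₀ : Fin n),
      RumorSpreading.law n {ω | min (RumorSpreading.diligenceBound 𝒢 c ω)
          (RumorSpreading.absDiligenceBound 𝒢 ω) < RumorSpreading.spreadTime 𝒢 v₀ ω} ≤
        ENNReal.ofReal ((n : ℝ) ^ (-c)) := by
  have hc0 : 0 ≤ c := by linarith
  constructor
  · intro n 𝒢 v₀
    rcases Nat.lt_or_ge n 2 with hn | hn
    -- A starting node exists, so `n = 1`, and the claimed bound `1 ^ (-c) = 1` is trivial.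
    · have h1 : n = 1 := by have := v₀.pos; omega
      subst h1
      simpa using prob_le_one
    · refine (measure_mono (RumorSpreading.diligenceBound_lt_subset 𝒢 v₀ c)).trans
        ((RumorSpreading.law_late_diligence_le hc0 hn 𝒢 v₀).trans (ENNReal.ofReal_le_ofReal ?_))
      have : (1 : ℝ) ≤ n := by exact_mod_cast (by omega : 1 ≤ n)
      exact Real.rpow_le_rpow_of_exponent_le this (by linarith)
  · obtain ⟨n₁, hn₁⟩ := Filter.eventually_atTop.1
      (RumorSpreading.eventually_exp_le_rpow hc0)
    refine ⟨max n₁ 20, fun n hn 𝒢 v₀ => ?_⟩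
    have hn1 : n₁ ≤ n := (le_max_left _ _).trans hn
    have hn20 : 20 ≤ n := (le_max_right _ _).trans hn
    have hnr : (20 : ℝ) ≤ n := by exact_mod_cast hn20
    have hsub : {ω | min (RumorSpreading.diligenceBound 𝒢 c ω)
        (RumorSpreading.absDiligenceBound 𝒢 ω) < RumorSpreading.spreadTime 𝒢 v₀ ω} ⊆
        {ω | RumorSpreading.diligenceBound 𝒢 c ω < RumorSpreading.spreadTime 𝒢 v₀ ω} ∪
          {ω | RumorSpreading.absDiligenceBound 𝒢 ω < RumorSpreading.spreadTime 𝒢 v₀ ω} := by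
      intro ω (h : min (RumorSpreading.diligenceBound 𝒢 c ω)
        (RumorSpreading.absDiligenceBound 𝒢 ω) < RumorSpreading.spreadTime 𝒢 v₀ ω)
      rcases min_lt_iff.1 h with h | h
      · exact Or.inl h
      · exact Or.inr h
    refine (measure_mono hsub).trans ((measure_union_le _ _).trans ((add_le_add
      ((measure_mono (RumorSpreading.diligenceBound_lt_subset 𝒢 v₀ c)).trans
        (RumorSpreading.law_late_diligence_le hc0 (by omega) 𝒢 v₀))
      ((measure_mono (RumorSpreading.absDiligenceBound_lt_subset 𝒢 v₀)).trans
        (RumorSpreading.law_late_absDiligence_le hn20 𝒢 v₀))).trans ?_))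
    rw [← ENNReal.ofReal_add (by positivity) (Real.exp_nonneg _)]
    refine ENNReal.ofReal_le_ofReal ?_
    have h1 := hn₁ n hn1
    -- Each tail is at most `n ^ (-(c + 1))`, and the spare factor `n ≥ 2` absorbs their sum.
    have h2 : (n : ℝ) ^ (-c) = (n : ℝ) ^ (-(c + 1)) * n := by
      rw [← Real.rpow_add_one (by linarith)]
      congr 1
      ring
    have h3 : (0 : ℝ) ≤ (n : ℝ) ^ (-(c + 1)) := by positivity
    rw [h2]
    nlinarith
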